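/- Let $V\in C^1(\mathbb R^3)$ be a bounded complex-valued function, let $k\in\mathbb C$ with $\operatorname{Im}k>0$, and put $\lambda=k^2$. Let $-\Delta$ be the free Laplacian on $L^2(\mathbb R^3)$ with domain $H^2(\mathbb R^3)=\{u\in L^2:\Delta u\in L^2\}$. Then the resolvent $R_0(\lambda)=(-\Delta-\lambda I)^{-1}$ exists as a bounded operator on $L^2(\mathbb R^3)$, and for all $x,y\in\mathbb R^3$ the integral $$G_\lambda(x,y)=\frac1{16\pi^2}\int_{\mathbb R^3}\frac{e^{ik|x-z|}\,e^{ik|z-y|}}{|x-z|\,|z-y|}\,V(z)\,d^3z$$ converges absolutely. The function $G_\lambda$ is the integral kernel of $R_0(\lambda)VR_0(\lambda)$, that is, for every $f\in L^2(\mathbb R^3)$ and almost every $x$, $\big(R_0(\lambda)VR_0(\lambda)f\big)(x)=\int G_\lambda(x,y)f(y)\,d^3y$ with an absolutely convergent integral. Moreover, for all $x,y\in\mathbb R^3$, $$|G_\lambda(x,y)|\le\frac1{8|k|}\left(\frac1\pi\|V\|_\infty+\frac1{\sqrt2}\int_c^\infty\max_{E(x,y,r)}|\nabla V|\,\frac{r\,dr}{\sqrt{r^2-c^2}}\right),$$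 where $c=|x-y|/2$, $|\nabla V|=\big(\sum_{j=1}^3|\partial_jV|^2\big)^{1/2}$, and $E(x,y,r)=\{z\in\mathbb R^3:|z-x|+|z-y|=2r\}$ is the ellipsoid of revolution with foci $x$ and $y$ and semiaxes $r$ and $\sqrt{r^2-c^2}$ (a sphere of radius $r$ if $x=y$). The integral on the right takes its value in $[0,\infty]$, and the inequality is trivial if that value is $\infty$. -/

import Mathlib

open MeasureTheory Set
open scoped ENNReal BoundedContinuousFunction SchwartzMap Laplacian

/-- The configuration space `ℝ³` with its Euclidean norm and Lebesgue measure. -/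
abbrev R3 : Type := EuclideanSpace ℝ (Fin 3)

/-- The complex Hilbert space `L²(ℝ³)`. -/
abbrev L2R3 : Type := Lp (α := R3) ℂ 2

/-- `R` is the resolvent `(-Δ - z)⁻¹` of the free Laplacian on `L²(ℝ³)`.  Here `-Δ` is the operator
in `L²(ℝ³)` with domain `H²(ℝ³) = {u ∈ L² : Δu ∈ L²}`, where `Δu` is the distributional Laplacian.
The forward implication says `(-Δ - z) R f = f`, and the backward one that `R (-Δ - z) u = u` for
every `u` in the domain: `R` is the (hence unique) everywhere defined bounded two-sided inverse. -/
def IsFreeResolvent (z : ℂ) (R : L2R3 →L[ℂ] L2R3) : Prop :=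
  ∀ f u : L2R3, R f = u ↔
    -(Δ (Lp.toTemperedDistribution u)) - z • Lp.toTemperedDistribution u =
      Lp.toTemperedDistribution f

/-- The operator of multiplication by a bounded continuous potential, acting on `L²(ℝ³)`. -/
noncomputable def mulPotential (V : R3 →ᵇ ℂ) : L2R3 →L[ℂ] L2R3 :=
  (ContinuousLinearMap.mul ℂ ℂ).holderL volume ∞ 2 2 (V.memLp_top.toLp V)

/-- `K` is an integral kernel of the operator `T` on `L²(ℝ³)`: for every `f ∈ L²(ℝ³)` and almost
every `x`, the integral `∫ K(x,y) f(y) dy` converges absolutely and equals `(T f)(x)`. -/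
def IsIntegralKernel (T : L2R3 →L[ℂ] L2R3) (K : R3 → R3 → ℂ) : Prop :=
  ∀ f : L2R3, ∀ᵐ x : R3, Integrable (fun y : R3 => K x y * f y) ∧
    T f x = ∫ y : R3, K x y * f y

/-- The integrand `e^{ik|x-z|} e^{ik|z-y|} / (|x-z| |z-y|) · V(z)`. -/
noncomputable def kernelIntegrand (V : R3 → ℂ) (k : ℂ) (x y z : R3) : ℂ :=
  Complex.exp (Complex.I * k * ‖x - z‖) * Complex.exp (Complex.I * k * ‖z - y‖) /
    (‖x - z‖ * ‖z - y‖) * V z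

/-- The kernel `G_λ(x,y)`, `λ = k²`, of `R₀(λ) V R₀(λ)`. -/
noncomputable def greenKernel (V : R3 → ℂ) (k : ℂ) (x y : R3) : ℂ :=
  1 / (16 * (Real.pi : ℂ) ^ 2) * ∫ z : R3, kernelIntegrand V k x y z

/-- The gradient `∇V(z) = (∂₁V(z), ∂₂V(z), ∂₃V(z)) ∈ ℂ³` of a complex-valued function, so that
`‖grad V z‖² = ∑ⱼ |∂ⱼV(z)|²`. -/
noncomputable def grad (V : R3 → ℂ) (z : R3) : EuclideanSpace ℂ (Fin 3) :=
  WithLp.toLp 2 fun j => fderiv ℝ V z (EuclideanSpace.single j 1)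

/-- The ellipsoid of revolution (surface) with foci `x`, `y` and major semiaxis `r`; its other
semiaxes are `√(r² - c²)` with `c = |x-y|/2`. -/
def ellipsoid (x y : R3) (r : ℝ) : Set R3 := {z | ‖z - x‖ + ‖z - y‖ = 2 * r}

/-- `max_{E(x,y,r)} |∇V|`; for `r ≥ |x-y|/2` and `V` of class `C¹` it is a maximum over a non-empty
compact set, see `exists_maxGrad_eq`. -/
noncomputable def maxGrad (V : R3 → ℂ) (x y : R3) (r : ℝ) : ℝ≥0∞ :=
  ⨆ z ∈ ellipsoid x y r, ‖grad V z‖ₑ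

/-- `∫_c^∞ max_{E(x,y,r)} |∇V| · r / √(r² - c²) dr ∈ [0, ∞]`, with `c = |x-y|/2`. -/
noncomputable def gradIntegral (V : R3 → ℂ) (x y : R3) : ℝ≥0∞ :=
  ∫⁻ r in Ioi (‖x - y‖ / 2),
    maxGrad V x y r * ENNReal.ofReal (r / √(r ^ 2 - (‖x - y‖ / 2) ^ 2))

theorem mulPotential_coeFn (V : R3 →ᵇ ℂ) (f : L2R3) :
    mulPotential V f =ᵐ[volume] fun x => V x * f x := by
  have h1 := (ContinuousLinearMap.mul ℂ ℂ).coeFn_holder (r := 2)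
    ((V.memLp_top (μ := (volume : Measure R3))).toLp V) f
  have h2 := (V.memLp_top (μ := (volume : Measure R3))).coeFn_toLp
  filter_upwards [h1, h2] with x hx1 hx2
  have : mulPotential V f x = _ := hx1
  rw [this, hx2]
  rfl

theorem ellipsoid_isCompact (x y : R3) (r : ℝ) : IsCompact (ellipsoid x y r) := by
  apply Metric.isCompact_of_isClosed_isBounded
  · exact isClosed_eq (by fun_prop) continuous_const
  · refine (Metric.isBounded_closedBall (x := x) (r := 2 * r)).subset fun z hz => ?_
    rw [Metric.mem_closedBall, dist_eq_norm]
    have h : ‖z - x‖ + ‖z - y‖ = 2 * r := hz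
    linarith [norm_nonneg (z - y)]

theorem ellipsoid_nonempty (x y : R3) (r : ℝ) (hr : ‖x - y‖ / 2 ≤ r) :
    (ellipsoid x y r).Nonempty := by
  obtain ⟨e, he, hxy⟩ : ∃ e : R3, ‖e‖ = 1 ∧ x - y = ‖x - y‖ • e := by
    by_cases h : x = y
    · exact ⟨EuclideanSpace.single 0 1, by simp, by simp [h]⟩
    · have h0 : ‖x - y‖ ≠ 0 := norm_ne_zero_iff.2 (sub_ne_zero.2 h)
      exact ⟨‖x - y‖⁻¹ • (x - y), by rw [norm_smul, norm_inv, norm_norm, inv_mul_cancel₀ h0],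
        by rw [smul_smul, mul_inv_cancel₀ h0, one_smul]⟩
  refine ⟨x + (r - ‖x - y‖ / 2) • e, ?_⟩
  have h1 : x + (r - ‖x - y‖ / 2) • e - x = (r - ‖x - y‖ / 2) • e := by abel
  have h2 : x + (r - ‖x - y‖ / 2) • e - y = (r + ‖x - y‖ / 2) • e := by
    have : x + (r - ‖x - y‖ / 2) • e - y = (x - y) + (r - ‖x - y‖ / 2) • e := by abel
    rw [this]
    nth_rewrite 1 [hxy]
    rw [← add_smul]
    congr 1
    ring
  have h3 := norm_nonneg (x - y)
  rw [ellipsoid, mem_ofPred_eq, h1, h2, norm_smul, norm_smul, he, Real.norm_of_nonneg (by linarith),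
    Real.norm_of_nonneg (by linarith)]
  ring

theorem exists_maxGrad_eq (V : R3 → ℂ) (hV : ContDiff ℝ 1 V) (x y : R3) (r : ℝ)
    (hr : ‖x - y‖ / 2 ≤ r) :
    ∃ z ∈ ellipsoid x y r, (∀ w ∈ ellipsoid x y r, ‖grad V w‖ ≤ ‖grad V z‖) ∧
      maxGrad V x y r = ENNReal.ofReal ‖grad V z‖ := by
  have hg : Continuous (grad V) := by
    have := hV.continuous_fderiv one_ne_zero
    unfold grad
    fun_prop
  obtain ⟨z, hz, hm⟩ := (ellipsoid_isCompact x y r).exists_isMaxOn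
    (ellipsoid_nonempty x y r hr) hg.norm.continuousOn
  refine ⟨z, hz, fun w hw => hm hw, ?_⟩
  rw [ofReal_norm]
  refine le_antisymm (iSup₂_le fun w hw => ?_) (le_iSup₂ (f := fun w _ => ‖grad V w‖ₑ) z hz)
  rw [← ofReal_norm, ← ofReal_norm]
  exact ENNReal.ofReal_le_ofReal (hm hw)

/-!
The resolvent is convolution with the Yukawa kernel `g(x) = e^{ik|x|} / (4π|x|)`, and everything
about the kernels is computed in prolate spheroidal coordinates `(φ, r, τ)`, `z = rτ b₀ + √(r² -
c²) √(1 - τ²) (cos φ b₁ + sin φ b₂)`, for which `|z ∓ c b₀| = r ∓ cτ` and `dz = (r² - c²τ²) dφ dr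
dτ` (`measurePreserving_spheroidal`).

*Resolvent.* For `c = 0` the coordinates are spherical with an arbitrary axis. They show that `g`
is integrable and that its inverse Fourier transform is `(4π²|ξ|² - k²)⁻¹` (`fourierInv_yukawa`).
As `4π²|ξ|² - k²` is the symbol of `-Δ - k²`, pairing `g(· - y)` with `(-Δ - k²)φ` gives `φ(y)`
for every Schwartz function `φ` (`integral_yukawa_mul_helmholtz`). By Young's inequality
convolution with `g` is bounded on `L²`, and by Fubini's theorem it is a right inverse of `-Δ -
k²`. The latter is injective on `L²` because its symbol has no zeros
(`eq_zero_of_helmholtz_eq_zero`), so the right inverse is two-sided.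

*Kernel.* `(R₀ V R₀ f)(x)` is the iterated integral of `g(x - z) V(z) g(z - y) f(y)`, and Young's
inequality, applied twice to absolute values, allows Fubini's theorem for almost every `x`.

*Bound.* In the coordinates with foci `x` and `y`, so `c = |x - y| / 2`, the volume element
cancels the denominator `|x - z| |z - y|`, and `16π² G(x, y) = ∫∫∫ e^{2ikr} V(z) dr dτ dφ`. For
fixed `φ` and `τ` one integrates by parts in `r` (`enorm_integral_exp_mul_le`): the boundary term
is at most `‖V‖ / (2|k|)`, and since `|∂z/∂r| ≤ r / √(r² - c²)` and `z` runs through the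
ellipsoids `E(x, y, r)`, the other term is at most the gradient integral over `2|k|`. The integral
over `τ` and `φ` contributes the factor `4π`. This proves the bound with `1/π` in place of the
larger constant `1/√2`.
-/

/-! ### Prolate spheroidal coordinates -/

/-- The map `(a, u, v) ↦ a b₀ + u b₁ + v b₂` attached to an orthonormal basis of `ℝ³`. -/
noncomputable def ofCoords (b : OrthonormalBasis (Fin 3) ℝ R3) (p : ℝ × ℝ × ℝ) : R3 :=
  p.1 • b 0 + p.2.1 • b 1 + p.2.2 • b 2

theorem measurePreserving_ofCoords (b : OrthonormalBasis (Fin 3) ℝ R3) :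
    MeasurePreserving (ofCoords b) := by
  have h1 := (MeasurePreserving.id (volume : Measure ℝ)).prod
    ((volume_preserving_finTwoArrow ℝ).symm _)
  have h2 := ((volume_preserving_piFinSuccAbove (fun _ : Fin 3 => ℝ) 0).symm _).comp h1
  have h3 := b.measurePreserving_repr_symm.comp
    ((PiLp.volume_preserving_toLp (Fin 3)).comp h2)
  have h4 : ofCoords b = b.repr.symm ∘ WithLp.toLp 2 ∘
      (MeasurableEquiv.piFinSuccAbove (fun _ : Fin 3 => ℝ) 0).symm ∘
        Prod.map id MeasurableEquiv.finTwoArrow.symm := by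
    funext p
    simp only [Function.comp_apply]
    rw [← b.sum_repr_symm, Fin.sum_univ_three]
    rfl
  rw [h4]
  exact h3

theorem norm_ofCoords_sq (b : OrthonormalBasis (Fin 3) ℝ R3) (p : ℝ × ℝ × ℝ) :
    ‖ofCoords b p‖ ^ 2 = p.1 ^ 2 + p.2.1 ^ 2 + p.2.2 ^ 2 := by
  have h := orthonormal_iff_ite.1 b.orthonormal
  rw [← real_inner_self_eq_norm_sq]
  simp only [ofCoords, inner_add_left, inner_add_right, inner_smul_left, inner_smul_right, h]
  simp
  ring

theorem inner_ofCoords (b : OrthonormalBasis (Fin 3) ℝ R3) (p : ℝ × ℝ × ℝ) :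
    inner ℝ (ofCoords b p) (b 0) = p.1 := by
  have h := orthonormal_iff_ite.1 b.orthonormal
  simp [ofCoords, inner_add_left, inner_smul_left, h]

/-- Elliptic coordinates `(r, τ) ↦ (rτ, √((r² - c²)(1 - τ²)))` of the open upper half plane, with
foci `(±c, 0)`. -/
noncomputable def elliptic (c : ℝ) (p : ℝ × ℝ) : ℝ × ℝ :=
  (p.1 * p.2, √(p.1 ^ 2 - c ^ 2) * √(1 - p.2 ^ 2))

/-- Every point `(a, ρ)` with `ρ > 0` lies on the ellipse
`a² / r² + ρ² / (r² - c²) = 1` for some `r > c`. -/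
theorem elliptic_image (c : ℝ) (hc : 0 ≤ c) :
    elliptic c '' (Ioi c ×ˢ Ioo (-1) 1) = univ ×ˢ Ioi 0 := by
  ext ⟨a, ρ⟩
  simp only [mem_image, mem_prod, mem_Ioi, mem_Ioo, mem_univ, true_and, Prod.exists, elliptic,
    Prod.mk.injEq]
  constructor
  · rintro ⟨r, τ, ⟨hr, h1, h2⟩, -, rfl⟩
    have : 0 < r ^ 2 - c ^ 2 := by nlinarith
    have : 0 < 1 - τ ^ 2 := by nlinarith
    positivity
  · intro hρ
    -- `t = r²` is the larger root of `(t - c²)(t - a²) = ρ² t`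
    set S := a ^ 2 + ρ ^ 2 + c ^ 2 with hS
    set D := S ^ 2 - 4 * a ^ 2 * c ^ 2 with hD
    have hD0 : 0 ≤ D := by
      have : D = (a ^ 2 - c ^ 2) ^ 2 + ρ ^ 2 * (ρ ^ 2 + 2 * a ^ 2 + 2 * c ^ 2) := by
        rw [hD, hS]; ring
      rw [this]; positivity
    set t := (S + √D) / 2 with ht
    have hsq := Real.sq_sqrt hD0
    have hroot : (t - c ^ 2) * (t - a ^ 2) = ρ ^ 2 * t := by
      rw [ht]; linear_combination (1 / 4) * hsq + (1 / 4 : ℝ) * hD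
    have hta : a ^ 2 < t := by
      rcases lt_or_ge (a ^ 2 - ρ ^ 2 - c ^ 2) 0 with h | h
      · have := Real.sqrt_nonneg D
        rw [ht, hS]; linarith
      · have ha : 0 < a ^ 2 := by nlinarith [sq_nonneg c, pow_pos hρ 2]
        have : a ^ 2 - ρ ^ 2 - c ^ 2 < √D := by
          rw [Real.lt_sqrt h, hD, hS]
          nlinarith [mul_pos ha (pow_pos hρ 2)]
        rw [ht, hS]; linarith
    have htc : c ^ 2 < t := by
      rcases lt_or_ge (c ^ 2 - ρ ^ 2 - a ^ 2) 0 with h | h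
      · have := Real.sqrt_nonneg D
        rw [ht, hS]; linarith
      · have ha : 0 < c ^ 2 := by nlinarith [sq_nonneg a, pow_pos hρ 2]
        have : c ^ 2 - ρ ^ 2 - a ^ 2 < √D := by
          rw [Real.lt_sqrt h, hD, hS]
          nlinarith [mul_pos ha (pow_pos hρ 2)]
        rw [ht, hS]; linarith
    have ht0 : 0 < t := lt_of_le_of_lt (sq_nonneg a) hta
    have hr0 : 0 < √t := Real.sqrt_pos.2 ht0
    have hr2 : √t ^ 2 = t := Real.sq_sqrt ht0.le
    have hτ : |a / √t| < 1 := by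
      rw [abs_div, abs_of_pos hr0, div_lt_one hr0]
      exact Real.lt_sqrt_of_sq_lt (by rwa [sq_abs])
    refine ⟨√t, a / √t, ⟨Real.lt_sqrt_of_sq_lt htc, abs_lt.1 hτ⟩, by field_simp, ?_⟩
    rw [← Real.sqrt_mul (by rw [hr2]; linarith), Real.sqrt_eq_iff_eq_sq _ hρ.le]
    · rw [div_pow, hr2]
      field_simp
      linarith
    · have : 0 ≤ 1 - (a / √t) ^ 2 := by
        have := (sq_lt_one_iff_abs_lt_one _).2 hτ
        linarith
      exact mul_nonneg (by rw [hr2]; linarith) this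

theorem elliptic_injOn (c : ℝ) (hc : 0 ≤ c) : InjOn (elliptic c) (Ioi c ×ˢ Ioo (-1) 1) := by
  have key : ∀ r τ : ℝ, c < r → -1 < τ → τ < 1 → (r ^ 2 - c ^ 2) * (r ^ 2 - (r * τ) ^ 2) =
      (√(r ^ 2 - c ^ 2) * √(1 - τ ^ 2)) ^ 2 * r ^ 2 := by
    intro r τ hr h1 h2
    have h3 : 0 ≤ r ^ 2 - c ^ 2 := by nlinarith
    have h4 : 0 ≤ 1 - τ ^ 2 := by nlinarith
    rw [mul_pow (√_), Real.sq_sqrt h3, Real.sq_sqrt h4]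
    ring
  rintro ⟨r, τ⟩ ⟨hr : c < r, h1 : -1 < τ, h2 : τ < 1⟩ ⟨r', τ'⟩
    ⟨hr' : c < r', h1' : -1 < τ', h2' : τ' < 1⟩ h
  simp only [elliptic, Prod.mk.injEq] at h
  have e1 := key r τ hr h1 h2
  have e2 := key r' τ' hr' h1' h2'
  rw [h.1, h.2] at e1
  have hr0 : 0 < r := by linarith
  have hr0' : 0 < r' := by linarith
  have hlt : (r' * τ') ^ 2 < r ^ 2 := by
    rw [← h.1, mul_pow]
    have : τ ^ 2 < 1 := by nlinarith
    exact mul_lt_of_lt_one_right (pow_pos hr0 2) this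
  have hlt' : c ^ 2 < r' ^ 2 := by nlinarith
  -- with `a = rτ`, two distinct solutions of `(t - c²)(t - a²) = ρ² t` have product `a² c²`,
  -- which is impossible as `r² > a²` and `r'² > c²`
  have hrr : r ^ 2 = r' ^ 2 := by
    by_contra hne
    have hz : (r ^ 2 - r' ^ 2) * (r ^ 2 * r' ^ 2 - (r' * τ') ^ 2 * c ^ 2) = 0 := by
      linear_combination r' ^ 2 * e1 - r ^ 2 * e2
    rcases mul_eq_zero.1 hz with h0 | h0
    · exact hne (by linarith)
    · nlinarith [mul_pos (sub_pos.2 hlt) (pow_pos hr0' 2),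
        mul_nonneg (sq_nonneg (r' * τ')) (sub_pos.2 hlt').le]
  have hreq : r = r' := by nlinarith
  subst hreq
  simp only [Prod.mk.injEq, true_and]
  exact mul_left_cancel₀ hr0.ne' h.1

/-- The derivative of `elliptic c` at a point of `(c, ∞) × (-1, 1)`. -/
noncomputable def fderivElliptic (c : ℝ) (p : ℝ × ℝ) : ℝ × ℝ →L[ℝ] ℝ × ℝ :=
  (Matrix.toLin (.finTwoProd ℝ) (.finTwoProd ℝ)
    !![p.2, p.1;
      p.1 / √(p.1 ^ 2 - c ^ 2) * √(1 - p.2 ^ 2),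
      √(p.1 ^ 2 - c ^ 2) * (-p.2 / √(1 - p.2 ^ 2))]).toContinuousLinearMap

theorem hasDerivAt_sqrt_sq_sub (c r : ℝ) (h : 0 < r ^ 2 - c ^ 2) :
    HasDerivAt (fun r => √(r ^ 2 - c ^ 2)) (r / √(r ^ 2 - c ^ 2)) r := by
  have := ((hasDerivAt_pow 2 r).sub_const (c ^ 2)).sqrt h.ne'
  convert this using 1
  field_simp
  ring

theorem hasDerivAt_sqrt_one_sub_sq (τ : ℝ) (h : 0 < 1 - τ ^ 2) :
    HasDerivAt (fun τ : ℝ => √(1 - τ ^ 2)) (-τ / √(1 - τ ^ 2)) τ := by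
  have := ((hasDerivAt_pow 2 τ).const_sub 1).sqrt h.ne'
  convert this using 1
  field_simp
  ring

theorem hasFDerivAt_elliptic (c : ℝ) (p : ℝ × ℝ) (h1 : 0 < p.1 ^ 2 - c ^ 2)
    (h2 : 0 < 1 - p.2 ^ 2) : HasFDerivAt (elliptic c) (fderivElliptic c p) p := by
  unfold fderivElliptic
  rw [Matrix.toLin_finTwoProd_toContinuousLinearMap]
  convert!
    HasFDerivAt.prodMk (𝕜 := ℝ)
      (HasFDerivAt.fun_mul (hasFDerivAt_fst (𝕜 := ℝ) (p := p)) hasFDerivAt_snd)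
      (HasFDerivAt.fun_mul ((hasDerivAt_sqrt_sq_sub c p.1 h1).comp_hasFDerivAt p hasFDerivAt_fst)
        ((hasDerivAt_sqrt_one_sub_sq p.2 h2).comp_hasFDerivAt p hasFDerivAt_snd)) using 2
  · simp [add_comm]
  · simp [smul_smul, add_comm, mul_comm]

/-- The Jacobian times `ρ = √((r² - c²)(1 - τ²))`, the factor which the rotation about the axis
contributes to the volume element of `ℝ³`. -/
theorem abs_det_fderivElliptic (c : ℝ) (p : ℝ × ℝ) (h1 : 0 < p.1 ^ 2 - c ^ 2)
    (h2 : 0 < 1 - p.2 ^ 2) :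
    |(fderivElliptic c p).det| * (√(p.1 ^ 2 - c ^ 2) * √(1 - p.2 ^ 2)) =
      p.1 ^ 2 - c ^ 2 * p.2 ^ 2 := by
  have s1 := Real.sqrt_pos.2 h1
  have s2 := Real.sqrt_pos.2 h2
  have q1 := Real.sq_sqrt h1.le
  have q2 := Real.sq_sqrt h2.le
  rw [← abs_of_pos (mul_pos s1 s2), ← abs_mul]
  have : (fderivElliptic c p).det * (√(p.1 ^ 2 - c ^ 2) * √(1 - p.2 ^ 2)) =
      -(p.1 ^ 2 - c ^ 2 * p.2 ^ 2) := by
    unfold fderivElliptic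
    simp only [LinearMap.det_toContinuousLinearMap, LinearMap.det_toLin, Matrix.det_fin_two_of]
    field_simp
    rw [q1, q2]
    ring
  rw [this, abs_neg, abs_of_nonneg]
  nlinarith [mul_nonneg (sq_nonneg c) h2.le]

/-- Prolate spheroidal coordinates `(φ, r, τ)` of `ℝ³` with axis `b 0` and foci `±c • b 0`. -/
noncomputable def spheroidal (b : OrthonormalBasis (Fin 3) ℝ R3) (c : ℝ) (p : ℝ × ℝ × ℝ) : R3 :=
  ofCoords b (p.2.1 * p.2.2, √(p.2.1 ^ 2 - c ^ 2) * √(1 - p.2.2 ^ 2) * Real.cos p.1,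
    √(p.2.1 ^ 2 - c ^ 2) * √(1 - p.2.2 ^ 2) * Real.sin p.1)

/-- The volume element `(r² - c²τ²) dφ dr dτ` of prolate spheroidal coordinates on their domain
`(-π, π) × (c, ∞) × (-1, 1)`. -/
noncomputable def spheroidalMeasure (c : ℝ) : Measure (ℝ × ℝ × ℝ) :=
  ((volume.restrict (Ioo (-Real.pi) Real.pi)).prod
    ((volume.restrict (Ioi c)).prod (volume.restrict (Ioo (-1) 1)))).withDensity
      fun p => ENNReal.ofReal (p.2.1 ^ 2 - c ^ 2 * p.2.2 ^ 2)

theorem continuous_ofCoords (b : OrthonormalBasis (Fin 3) ℝ R3) : Continuous (ofCoords b) := by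
  unfold ofCoords; fun_prop

theorem continuous_spheroidal (b : OrthonormalBasis (Fin 3) ℝ R3) (c : ℝ) :
    Continuous (spheroidal b c) := by
  unfold spheroidal ofCoords; fun_prop

/-- Integration in prolate spheroidal coordinates: cylindrical coordinates about the axis `b 0`
followed by elliptic coordinates in the meridian half planes. -/
theorem lintegral_spheroidal (b : OrthonormalBasis (Fin 3) ℝ R3) (c : ℝ) (hc : 0 ≤ c)
    (F : R3 → ℝ≥0∞) (hF : Measurable F) :
    ∫⁻ z, F z = ∫⁻ p, F (spheroidal b c p) ∂spheroidalMeasure c := by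
  have mΨ := (continuous_ofCoords b).measurable
  have mS := (continuous_spheroidal b c).measurable
  -- the integrand in cylindrical coordinates `(a, ρ, φ)`
  let N : ℝ → ℝ → ℝ → ℝ≥0∞ := fun φ a ρ =>
    ENNReal.ofReal ρ * F (ofCoords b (a, ρ * Real.cos φ, ρ * Real.sin φ))
  have mN : Measurable fun p : ℝ × ℝ × ℝ => N p.1 p.2.1 p.2.2 := by
    refine Measurable.mul (by fun_prop) (hF.comp (mΨ.comp ?_))
    fun_prop
  calc ∫⁻ z, F z = ∫⁻ p : ℝ × ℝ × ℝ, F (ofCoords b p) :=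
        ((measurePreserving_ofCoords b).lintegral_comp hF).symm
    _ = ∫⁻ a : ℝ, ∫⁻ q : ℝ × ℝ, F (ofCoords b (a, q)) := by
        rw [Measure.volume_eq_prod,
          lintegral_prod (fun p => F (ofCoords b p)) (hF.comp mΨ).aemeasurable]
    _ = ∫⁻ a : ℝ, ∫⁻ φ in Ioo (-Real.pi) Real.pi, ∫⁻ ρ in Ioi 0, N φ a ρ := by
        refine lintegral_congr fun a => ?_
        rw [← lintegral_comp_polarCoord_symm, polarCoord_target, Measure.volume_eq_prod,
          ← Measure.prod_restrict, lintegral_prod_symm]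
        · rfl
        · refine Measurable.aemeasurable ?_
          simp only [smul_eq_mul]
          refine Measurable.mul (by fun_prop) (hF.comp (mΨ.comp ?_))
          have := continuous_polarCoord_symm.measurable
          fun_prop
    _ = ∫⁻ φ in Ioo (-Real.pi) Real.pi, ∫⁻ a : ℝ, ∫⁻ ρ in Ioi 0, N φ a ρ := by
        rw [lintegral_lintegral_swap]
        refine Measurable.aemeasurable ?_
        refine Measurable.lintegral_prod_right' (f := fun q : (ℝ × ℝ) × ℝ => N q.1.2 q.1.1 q.2) ?_
        exact mN.comp (f := fun q : (ℝ × ℝ) × ℝ => (q.1.2, q.1.1, q.2)) (by fun_prop)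
    _ = ∫⁻ φ in Ioo (-Real.pi) Real.pi,
          ∫⁻ q in Ioi c ×ˢ Ioo (-1) 1, ENNReal.ofReal (q.1 ^ 2 - c ^ 2 * q.2 ^ 2) *
            F (spheroidal b c (φ, q)) := by
        refine lintegral_congr fun φ => ?_
        have m1 : Measurable fun p : ℝ × ℝ => N φ p.1 p.2 :=
          mN.comp (f := fun p : ℝ × ℝ => (φ, p)) (by fun_prop)
        have hms : MeasurableSet (Ioi c ×ˢ Ioo (-1 : ℝ) 1) :=
          measurableSet_Ioi.prod measurableSet_Ioo
        have hprod : (volume : Measure ℝ).prod (volume.restrict (Ioi (0 : ℝ))) =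
            (volume : Measure (ℝ × ℝ)).restrict (univ ×ˢ Ioi 0) := by
          rw [Measure.volume_eq_prod, ← Measure.prod_restrict, Measure.restrict_univ]
        rw [← lintegral_prod (μ := volume) (ν := volume.restrict (Ioi 0))
          (fun p : ℝ × ℝ => N φ p.1 p.2) m1.aemeasurable, hprod, ← elliptic_image c hc]
        have hpos : ∀ p ∈ Ioi c ×ˢ Ioo (-1 : ℝ) 1, 0 < p.1 ^ 2 - c ^ 2 ∧ 0 < 1 - p.2 ^ 2 := by
          rintro ⟨r, τ⟩ ⟨hr : c < r, h1 : -1 < τ, h2 : τ < 1⟩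
          exact ⟨by nlinarith, by nlinarith⟩
        rw [lintegral_image_eq_lintegral_abs_det_fderiv_mul volume hms
          (fun p hp => (hasFDerivAt_elliptic c p (hpos p hp).1 (hpos p hp).2).hasFDerivWithinAt)
          (elliptic_injOn c hc)]
        refine setLIntegral_congr_fun hms fun p hp => ?_
        simp only [N, elliptic]
        rw [← mul_assoc, ← ENNReal.ofReal_mul (abs_nonneg _),
          abs_det_fderivElliptic c p (hpos p hp).1 (hpos p hp).2]
        rfl
    _ = ∫⁻ p, F (spheroidal b c p) ∂spheroidalMeasure c := by
        rw [spheroidalMeasure, lintegral_withDensity_eq_lintegral_mul _ (by fun_prop)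
          (g := fun p => F (spheroidal b c p)) (hF.comp mS), lintegral_prod]
        · rw [Measure.prod_restrict, ← Measure.volume_eq_prod]; rfl
        · exact (Measurable.mul (by fun_prop) (hF.comp mS)).aemeasurable

/-- Prolate spheroidal coordinates carry `(r² - c²τ²) dφ dr dτ` to Lebesgue measure.  For `c = 0`
these are spherical coordinates with axis `b 0`. -/
theorem measurePreserving_spheroidal (b : OrthonormalBasis (Fin 3) ℝ R3) (c : ℝ) (hc : 0 ≤ c) :
    MeasurePreserving (spheroidal b c) (spheroidalMeasure c) volume := by
  have mS := (continuous_spheroidal b c).measurable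
  refine ⟨mS, Measure.ext_of_lintegral _ fun F hF => ?_⟩
  rw [lintegral_map hF mS, lintegral_spheroidal b c hc F hF]

/-- The measure `dφ dr dτ` on the domain of prolate spheroidal coordinates. -/
noncomputable abbrev spheroidalBase (c : ℝ) : Measure (ℝ × ℝ × ℝ) :=
  (volume.restrict (Ioo (-Real.pi) Real.pi)).prod
    ((volume.restrict (Ioi c)).prod (volume.restrict (Ioo (-1) 1)))

theorem ae_spheroidalBase (c : ℝ) :
    ∀ᵐ p ∂spheroidalBase c, c < p.2.1 ∧ -1 < p.2.2 ∧ p.2.2 < 1 := by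
  rw [spheroidalBase, Measure.prod_restrict, Measure.prod_restrict]
  filter_upwards [ae_restrict_mem
    (measurableSet_Ioo.prod (measurableSet_Ioi.prod measurableSet_Ioo))] with p hp
  exact ⟨hp.2.1, hp.2.2⟩

theorem toReal_ofReal_density_ae_eq (c : ℝ) (hc : 0 ≤ c) :
    ∀ᵐ p ∂spheroidalBase c, (ENNReal.ofReal (p.2.1 ^ 2 - c ^ 2 * p.2.2 ^ 2)).toReal =
      p.2.1 ^ 2 - c ^ 2 * p.2.2 ^ 2 := by
  filter_upwards [ae_spheroidalBase c] with p ⟨h1, h2, h3⟩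
  refine ENNReal.toReal_ofReal ?_
  have : p.2.2 ^ 2 ≤ 1 := by nlinarith
  nlinarith [mul_le_mul_of_nonneg_left this (sq_nonneg c)]

theorem integrable_spheroidal_iff {E : Type*} [NormedAddCommGroup E] [NormedSpace ℝ E]
    (b : OrthonormalBasis (Fin 3) ℝ R3) (c : ℝ) (hc : 0 ≤ c) {f : R3 → E}
    (hf : AEStronglyMeasurable f) :
    Integrable f ↔ Integrable (fun p => (p.2.1 ^ 2 - c ^ 2 * p.2.2 ^ 2) • f (spheroidal b c p))
      (spheroidalBase c) := by
  have h := measurePreserving_spheroidal b c hc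
  rw [← h.map_eq] at hf ⊢
  rw [integrable_map_measure hf h.aemeasurable, spheroidalMeasure,
    integrable_withDensity_iff_integrable_smul' (by fun_prop) (by simp)]
  refine integrable_congr ?_
  filter_upwards [toReal_ofReal_density_ae_eq c hc] with p hp
  rw [hp, Function.comp_apply]

theorem integral_spheroidal {E : Type*} [NormedAddCommGroup E] [NormedSpace ℝ E]
    (b : OrthonormalBasis (Fin 3) ℝ R3) (c : ℝ) (hc : 0 ≤ c) {f : R3 → E}
    (hf : AEStronglyMeasurable f) :
    ∫ z, f z = ∫ p, (p.2.1 ^ 2 - c ^ 2 * p.2.2 ^ 2) • f (spheroidal b c p)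
      ∂spheroidalBase c := by
  have h := measurePreserving_spheroidal b c hc
  rw [← h.map_eq] at hf ⊢
  rw [integral_map h.aemeasurable hf, spheroidalMeasure,
    integral_withDensity_eq_integral_toReal_smul (by fun_prop) (by simp)]
  refine integral_congr_ae ?_
  filter_upwards [toReal_ofReal_density_ae_eq c hc] with p hp
  rw [hp]

/-- The distance to the foci: with `s = c` and `s = -c` this reads `|z - c b₀| = r - cτ` and
`|z + c b₀| = r + cτ`. -/
theorem norm_spheroidal_sub_smul (b : OrthonormalBasis (Fin 3) ℝ R3) (c s : ℝ)
    (hs : s ^ 2 = c ^ 2) (p : ℝ × ℝ × ℝ) (h1 : |c| ≤ p.2.1) (h2 : |p.2.2| ≤ 1) :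
    ‖spheroidal b c p - s • b 0‖ = p.2.1 - s * p.2.2 := by
  have e : spheroidal b c p - s • b 0 = ofCoords b (p.2.1 * p.2.2 - s,
      √(p.2.1 ^ 2 - c ^ 2) * √(1 - p.2.2 ^ 2) * Real.cos p.1,
      √(p.2.1 ^ 2 - c ^ 2) * √(1 - p.2.2 ^ 2) * Real.sin p.1) := by
    simp only [spheroidal, ofCoords, sub_smul]
    abel
  have h3 : 0 ≤ p.2.1 ^ 2 - c ^ 2 := sub_nonneg.2 (sq_le_sq.2 (h1.trans (le_abs_self _)))
  have h4 : 0 ≤ 1 - p.2.2 ^ 2 := by nlinarith [sq_abs p.2.2, abs_nonneg p.2.2]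
  have h5 : s * p.2.2 ≤ p.2.1 := by
    calc s * p.2.2 ≤ |s * p.2.2| := le_abs_self _
      _ = |c| * |p.2.2| := by rw [abs_mul, (sq_eq_sq_iff_abs_eq_abs _ _).1 hs]
      _ ≤ |c| * 1 := by gcongr
      _ ≤ p.2.1 := by linarith
  rw [← sq_eq_sq₀ (norm_nonneg _) (by linarith), e, norm_ofCoords_sq]
  simp only [mul_pow, Real.sq_sqrt h3, Real.sq_sqrt h4]
  linear_combination (p.2.1 ^ 2 - c ^ 2) * (1 - p.2.2 ^ 2) * Real.sin_sq_add_cos_sq p.1 +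
    (1 - p.2.2 ^ 2) * hs

theorem norm_spheroidal_zero (b : OrthonormalBasis (Fin 3) ℝ R3) (p : ℝ × ℝ × ℝ)
    (h1 : 0 ≤ p.2.1) (h2 : |p.2.2| ≤ 1) : ‖spheroidal b 0 p‖ = p.2.1 := by
  simpa using norm_spheroidal_sub_smul b 0 0 rfl p (by simpa using h1) h2

/-- Every vector lies on the nonnegative half-axis of some orthonormal basis. -/
theorem exists_orthonormalBasis_eq_norm_smul (v : R3) :
    ∃ b : OrthonormalBasis (Fin 3) ℝ R3, v = ‖v‖ • b 0 := by
  by_cases hv : v = 0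
  · exact ⟨EuclideanSpace.basisFun (Fin 3) ℝ, by simp [hv]⟩
  have h0 : ‖v‖ ≠ 0 := norm_ne_zero_iff.2 hv
  have ho : Orthonormal ℝ (({0} : Set (Fin 3)).domRestrict fun _ => ‖v‖⁻¹ • v) := by
    refine ⟨fun i => ?_, fun i j hij => (hij (Subsingleton.elim i j)).elim⟩
    simp [norm_smul, h0]
  obtain ⟨b, hb⟩ := ho.exists_orthonormalBasis_extension_of_card_eq (by simp)
  refine ⟨b, ?_⟩
  rw [hb 0 rfl, smul_smul, mul_inv_cancel₀ h0, one_smul]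

/-! ### The Yukawa kernel and its Fourier transform -/

/-- The outgoing fundamental solution `e^{ik|x|} / (4π|x|)` of the Helmholtz operator `-Δ - k²`. -/
noncomputable def yukawa (k : ℂ) (x : R3) : ℂ :=
  Complex.exp (Complex.I * k * ‖x‖) / (4 * Real.pi * ‖x‖)

theorem measurable_yukawa (k : ℂ) : Measurable (yukawa k) := by
  unfold yukawa; fun_prop

theorem tendsto_exp_mul_atTop_zero {w : ℂ} (hw : w.re < 0) :
    Filter.Tendsto (fun r : ℝ => Complex.exp (w * r)) Filter.atTop (nhds 0) := by
  rw [tendsto_zero_iff_norm_tendsto_zero]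
  simp only [Complex.norm_exp, Complex.re_mul_ofReal]
  exact Real.tendsto_exp_atBot.comp (Filter.tendsto_id.const_mul_atTop_of_neg hw)

theorem tendsto_mul_exp_mul_atTop_zero {w : ℂ} (hw : w.re < 0) :
    Filter.Tendsto (fun r : ℝ => (r : ℂ) * Complex.exp (w * r)) Filter.atTop (nhds 0) := by
  rw [tendsto_zero_iff_norm_tendsto_zero]
  have := tendsto_rpow_mul_exp_neg_mul_atTop_nhds_zero 1 (-w.re) (by linarith)
  refine this.congr' ?_
  filter_upwards [Filter.eventually_ge_atTop 0] with r hr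
  simp [Complex.norm_exp, abs_of_nonneg hr]

theorem integrableOn_mul_exp_mul_Ioi {w : ℂ} (hw : w.re < 0) :
    IntegrableOn (fun r : ℝ => (r : ℂ) * Complex.exp (w * r)) (Ioi 0) := by
  have h := integrableOn_rpow_mul_exp_neg_mul_rpow (p := 1) (s := 1) (b := -w.re) (by norm_num)
    one_pos (by linarith)
  refine Integrable.mono' h (by fun_prop) ?_
  filter_upwards [ae_restrict_mem measurableSet_Ioi] with r hr
  simp [Complex.norm_exp, abs_of_pos (mem_Ioi.1 hr)]

theorem integral_mul_exp_mul_Ioi {w : ℂ} (hw : w.re < 0) :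
    ∫ r : ℝ in Ioi 0, (r : ℂ) * Complex.exp (w * r) = 1 / w ^ 2 := by
  have hw0 : w ≠ 0 := by rintro rfl; simp at hw
  have hd : ∀ r : ℝ, HasDerivAt (fun r : ℝ => ((r : ℂ) * Complex.exp (w * r)) / w -
      Complex.exp (w * r) / w ^ 2) ((r : ℂ) * Complex.exp (w * r)) r := by
    intro r
    have h0 : HasDerivAt (fun r : ℝ => (r : ℂ)) 1 r := Complex.ofRealCLM.hasDerivAt
    have h1 : HasDerivAt (fun r : ℝ => Complex.exp (w * r)) (Complex.exp (w * r) * (w * 1)) r :=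
      (h0.const_mul w).cexp
    refine HasDerivAt.congr_deriv (((h0.mul h1).div_const w).sub (h1.div_const (w ^ 2))) ?_
    field_simp
    ring
  have ht := ((tendsto_mul_exp_mul_atTop_zero hw).div_const w).sub
    ((tendsto_exp_mul_atTop_zero hw).div_const (w ^ 2))
  rw [integral_Ioi_of_hasDerivAt_of_tendsto' (fun r _ => hd r) (integrableOn_mul_exp_mul_Ioi hw) ht]
  simp

theorem re_I_mul_neg {k : ℂ} (hk : 0 < k.im) (s : ℝ) : (Complex.I * (k + s)).re < 0 := by
  simpa using hk

theorem integrable_yukawa {k : ℂ} (hk : 0 < k.im) : Integrable (yukawa k) := by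
  rw [integrable_spheroidal_iff (EuclideanSpace.basisFun (Fin 3) ℝ) 0 le_rfl
    (measurable_yukawa k).aestronglyMeasurable]
  have h := integrableOn_mul_exp_mul_Ioi (re_I_mul_neg hk 0)
  have h1 := ((h.comp_fst (volume.restrict (Ioo (-1 : ℝ) 1))).comp_snd
    (volume.restrict (Ioo (-Real.pi) Real.pi))).const_mul (1 / (4 * Real.pi : ℂ))
  refine h1.congr ?_
  filter_upwards [ae_spheroidalBase 0] with p ⟨h2, h3, h4⟩
  have hp : (p.2.1 : ℂ) ≠ 0 := by exact_mod_cast h2.ne'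
  rw [yukawa, norm_spheroidal_zero _ _ h2.le (abs_le.2 ⟨h3.le, h4.le⟩)]
  simp
  field_simp

/-- An antiderivative is `τ / (k (k + sτ))`, which makes sense for `s = 0` too. -/
theorem integral_one_div_sq {k : ℂ} (hk : 0 < k.im) (s : ℝ) :
    ∫ τ in Ioo (-1 : ℝ) 1, 1 / (k + s * τ) ^ 2 = 2 / (k ^ 2 - s ^ 2) := by
  have hne : ∀ t : ℝ, k + t ≠ 0 := fun t h => by
    have := congrArg Complex.im h
    simp at this
    exact hk.ne' this
  have hk0 : k ≠ 0 := by simpa using hne 0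
  have hne' : ∀ τ : ℝ, k + s * τ ≠ 0 := fun τ => by exact_mod_cast hne (s * τ)
  have hd : ∀ τ : ℝ, HasDerivAt (fun τ : ℝ => (τ : ℂ) / (k * (k + s * τ)))
      (1 / (k + s * τ) ^ 2) τ := by
    intro τ
    have h0 : HasDerivAt (fun r : ℝ => (r : ℂ)) 1 τ := Complex.ofRealCLM.hasDerivAt
    have h1 := h0.div (((h0.const_mul (s : ℂ)).const_add k).const_mul k)
      (mul_ne_zero hk0 (hne' τ))
    have := hne' τ
    refine HasDerivAt.congr_deriv h1 ?_
    field_simp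
    ring
  have hcont : Continuous fun τ : ℝ => 1 / (k + s * τ) ^ 2 :=
    continuous_const.div (by fun_prop) fun τ => pow_ne_zero 2 (hne' τ)
  rw [← integral_Ioc_eq_integral_Ioo, ← intervalIntegral.integral_of_le (by norm_num),
    intervalIntegral.integral_eq_sub_of_hasDerivAt (fun τ _ => hd τ)
      (hcont.intervalIntegrable _ _)]
  have h1 := hne s
  have h2 : k - s ≠ 0 := by simpa [sub_eq_add_neg] using hne (-s)
  have h3 : k ^ 2 - s ^ 2 ≠ 0 := by rw [sq_sub_sq]; exact mul_ne_zero h1 h2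
  push_cast
  simp only [mul_one, mul_neg, ← sub_eq_add_neg]
  field_simp
  ring

open FourierTransform in
/-- The radial integral `∫ r e^{i(k + 2π|ξ|τ) r} dr = -(k + 2π|ξ|τ)⁻²` in spherical coordinates
with axis `ξ` is followed by an elementary integral over `τ`. -/
theorem fourierInv_yukawa {k : ℂ} (hk : 0 < k.im) (ξ : R3) :
    𝓕⁻ (yukawa k) ξ = ((((2 * Real.pi) ^ 2 * ‖ξ‖ ^ 2 : ℝ) : ℂ) - k ^ 2)⁻¹ := by
  obtain ⟨b, hb⟩ := exists_orthonormalBasis_eq_norm_smul ξ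
  set s : ℝ := 2 * Real.pi * ‖ξ‖ with hs
  have hmeas : AEStronglyMeasurable (fun v : R3 =>
      Complex.exp ((2 * Real.pi * inner ℝ v ξ : ℝ) * Complex.I) • yukawa k v) :=
    Measurable.aestronglyMeasurable (by
      have := measurable_yukawa k
      fun_prop)
  have hint : Integrable (fun q : ℝ × ℝ => (q.1 : ℂ) *
      Complex.exp (Complex.I * (k + (s * q.2 : ℝ)) * q.1))
      ((volume.restrict (Ioi (0 : ℝ))).prod (volume.restrict (Ioo (-1 : ℝ) 1))) := by
    have h := integrableOn_mul_exp_mul_Ioi (re_I_mul_neg hk 0)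
    refine (h.comp_fst (volume.restrict (Ioo (-1 : ℝ) 1))).mono (by fun_prop) ?_
    refine Filter.Eventually.of_forall fun q => ?_
    simp [Complex.norm_exp]
  rw [Real.fourierInv_eq', integral_spheroidal b 0 le_rfl hmeas]
  let F : ℝ × ℝ → ℂ := fun q => 1 / (4 * Real.pi : ℂ) * ((q.1 : ℂ) *
    Complex.exp (Complex.I * (k + (s * q.2 : ℝ)) * q.1))
  calc _ = ∫ p : ℝ × ℝ × ℝ, F p.2 ∂spheroidalBase 0 := by
        refine integral_congr_ae ?_
        filter_upwards [ae_spheroidalBase 0] with p ⟨h2, h3, h4⟩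
        have hp : (p.2.1 : ℂ) ≠ 0 := by exact_mod_cast h2.ne'
        have hinner : inner ℝ (spheroidal b 0 p) ξ = ‖ξ‖ * (p.2.1 * p.2.2) := by
          rw [hb, inner_smul_right, spheroidal, inner_ofCoords, ← hb]
        simp only [F]
        rw [yukawa, norm_spheroidal_zero _ _ h2.le (abs_le.2 ⟨h3.le, h4.le⟩), hinner,
          show Complex.I * (k + (s * p.2.2 : ℝ)) * p.2.1 =
            (2 * Real.pi * (‖ξ‖ * (p.2.1 * p.2.2)) : ℝ) * Complex.I + Complex.I * k * p.2.1 by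
              rw [hs]; push_cast; ring, Complex.exp_add]
        simp only [Complex.real_smul, smul_eq_mul]
        push_cast
        field_simp
        ring
    _ = (2 * Real.pi : ℝ) • (1 / (4 * Real.pi : ℂ) * ∫ τ in Ioo (-1 : ℝ) 1,
          ∫ r in Ioi (0 : ℝ), (r : ℂ) * Complex.exp (Complex.I * (k + (s * τ : ℝ)) * r)) := by
        refine (integral_fun_snd F).trans ?_
        rw [integral_const_mul, integral_prod_symm _ hint]
        congr 1
        simp [two_mul, Real.pi_pos.le]
    _ = (2 * Real.pi : ℝ) • (1 / (4 * Real.pi : ℂ) * ∫ τ in Ioo (-1 : ℝ) 1,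
          -(1 / (k + s * τ) ^ 2)) := by
        congr 3
        funext τ
        rw [integral_mul_exp_mul_Ioi (re_I_mul_neg hk _), mul_pow, Complex.I_sq]
        simp
    _ = _ := by
        rw [integral_neg, integral_one_div_sq hk s, Complex.real_smul]
        have hσ : (((2 * Real.pi) ^ 2 * ‖ξ‖ ^ 2 : ℝ) : ℂ) - k ^ 2 = -(k ^ 2 - s ^ 2) := by
          rw [hs]; push_cast; ring
        rw [hσ, inv_neg, div_eq_mul_inv 2]
        push_cast
        field_simp
        norm_num

/-! ### Convolution of an integrable with a square-integrable function -/

theorem lintegral_sq_le_measure_univ_mul {α : Type*} [MeasurableSpace α] (ν : Measure α)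
    {F : α → ℝ≥0∞} (hF : AEMeasurable F ν) :
    (∫⁻ x, F x ∂ν) ^ 2 ≤ ν univ * ∫⁻ x, F x ^ 2 ∂ν := by
  have h := ENNReal.lintegral_mul_le_Lp_mul_Lq ν Real.HolderConjugate.two_two
    (aemeasurable_const (b := (1 : ℝ≥0∞))) hF
  have h2 := pow_le_pow_left₀ zero_le h 2
  simp only [Pi.mul_apply, one_mul, ENNReal.one_rpow, lintegral_const] at h2
  refine h2.trans_eq ?_
  rw [mul_pow, ← ENNReal.rpow_natCast, ← ENNReal.rpow_mul, ← ENNReal.rpow_natCast,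
    ← ENNReal.rpow_mul]
  norm_num

/-- Young's inequality `‖G * F‖₂ ≤ ‖G‖₁ ‖F‖₂` for nonnegative functions, by the Cauchy–Schwarz
inequality for the measure `G(x - y) dy` and Tonelli's theorem. -/
theorem lintegral_conv_sq_le {G F : R3 → ℝ≥0∞} (hG : Measurable G) (hF : Measurable F) :
    ∫⁻ x, (∫⁻ y, G (x - y) * F y) ^ 2 ≤ (∫⁻ x, G x) ^ 2 * ∫⁻ x, F x ^ 2 := by
  have h1 : ∀ x, (∫⁻ y, G (x - y) * F y) ^ 2 ≤ (∫⁻ x, G x) * ∫⁻ y, G (x - y) * F y ^ 2 := by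
    intro x
    have hGx : Measurable fun y => G (x - y) := by fun_prop
    have h := lintegral_sq_le_measure_univ_mul (volume.withDensity fun y => G (x - y))
      hF.aemeasurable
    rwa [lintegral_withDensity_eq_lintegral_mul _ hGx hF,
      lintegral_withDensity_eq_lintegral_mul _ hGx (by fun_prop), withDensity_apply _ .univ,
      Measure.restrict_univ, lintegral_sub_left_eq_self G x] at h
  calc ∫⁻ x, (∫⁻ y, G (x - y) * F y) ^ 2
      ≤ ∫⁻ x, (∫⁻ x, G x) * ∫⁻ y, G (x - y) * F y ^ 2 := lintegral_mono h1
    _ = (∫⁻ x, G x) * ∫⁻ y, ∫⁻ x, G (x - y) * F y ^ 2 := by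
        rw [lintegral_const_mul _ (Measurable.lintegral_prod_right'
          (f := fun p : R3 × R3 => G (p.1 - p.2) * F p.2 ^ 2) (by fun_prop)),
          lintegral_lintegral_swap (by fun_prop)]
    _ = (∫⁻ x, G x) ^ 2 * ∫⁻ x, F x ^ 2 := by
        have : ∀ y, ∫⁻ x, G (x - y) * F y ^ 2 = (∫⁻ x, G x) * F y ^ 2 := fun y => by
          rw [lintegral_mul_const _ (by fun_prop), lintegral_sub_right_eq_self G y]
        simp_rw [this]
        rw [lintegral_const_mul _ (by fun_prop), sq, mul_assoc]

section Convolution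

variable {𝕜 : Type*} [RCLike 𝕜] {g f : R3 → 𝕜}

theorem eLpNorm_two_sq (u : R3 → 𝕜) : eLpNorm u 2 ^ 2 = ∫⁻ x, ‖u x‖ₑ ^ 2 := by
  have := eLpNorm_nnreal_pow_eq_lintegral (f := u) (p := 2) (μ := (volume : Measure R3))
    (by norm_num)
  simpa using this

theorem lintegral_enorm_sq_lt_top (hf : MemLp f 2) : ∫⁻ x, ‖f x‖ₑ ^ 2 < ∞ := by
  rw [← eLpNorm_two_sq]
  exact ENNReal.pow_lt_top hf.2

/-- The convolution of an integrable and a square-integrable function converges absolutely almost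
everywhere. -/
theorem ae_integrable_conv (hgm : Measurable g) (hg : Integrable g) (hfm : Measurable f)
    (hf : MemLp f 2) : ∀ᵐ x, Integrable fun y => g (x - y) * f y := by
  have h := lintegral_conv_sq_le hgm.enorm hfm.enorm
  have hlt : ∫⁻ x, (∫⁻ y, ‖g (x - y)‖ₑ * ‖f y‖ₑ) ^ 2 < ∞ := h.trans_lt
    (ENNReal.mul_lt_top (ENNReal.pow_lt_top hg.2) (lintegral_enorm_sq_lt_top hf))
  have hm : Measurable fun x => (∫⁻ y, ‖g (x - y)‖ₑ * ‖f y‖ₑ) ^ 2 :=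
    (Measurable.lintegral_prod_right'
      (f := fun p : R3 × R3 => ‖g (p.1 - p.2)‖ₑ * ‖f p.2‖ₑ) (by fun_prop)).pow_const 2
  filter_upwards [ae_lt_top hm hlt.ne] with x hx
  refine ⟨Measurable.aestronglyMeasurable (by fun_prop), ?_⟩
  simp only [HasFiniteIntegral, enorm_mul]
  exact (ENNReal.pow_lt_top_iff.1 hx).resolve_right two_ne_zero

theorem eLpNorm_conv_le (hgm : Measurable g) (hfm : Measurable f) :
    eLpNorm (fun x => ∫ y, g (x - y) * f y) 2 ≤ eLpNorm g 1 * eLpNorm f 2 := by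
  rw [← ENNReal.pow_le_pow_left_iff (n := 2) two_ne_zero, mul_pow, eLpNorm_two_sq,
    eLpNorm_two_sq, eLpNorm_one_eq_lintegral_enorm]
  refine le_trans (lintegral_mono fun x => ?_) (lintegral_conv_sq_le hgm.enorm hfm.enorm)
  refine pow_le_pow_left₀ zero_le ((enorm_integral_le_lintegral_enorm _).trans_eq ?_) 2
  simp only [enorm_mul]

theorem measurable_conv (hgm : Measurable g) (hfm : Measurable f) :
    Measurable fun x => ∫ y, g (x - y) * f y := by
  refine StronglyMeasurable.measurable ?_
  refine StronglyMeasurable.integral_prod_right' (f := fun p : R3 × R3 => g (p.1 - p.2) * f p.2) ?_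
  exact Measurable.stronglyMeasurable (by fun_prop)

theorem memLp_conv (hgm : Measurable g) (hg : Integrable g) (hfm : Measurable f)
    (hf : MemLp f 2) : MemLp (fun x => ∫ y, g (x - y) * f y) 2 :=
  ⟨(measurable_conv hgm hfm).aestronglyMeasurable, (eLpNorm_conv_le hgm hfm).trans_lt
    (ENNReal.mul_lt_top (memLp_one_iff_integrable.2 hg).2 hf.2)⟩

end Convolution

theorem measurable_coeFn_L2R3 (f : L2R3) : Measurable f := (Lp.stronglyMeasurable f).measurable

/-- Convolution with an integrable function `g`, as a bounded operator on `L²(ℝ³)`. -/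
noncomputable def convL2 (g : R3 → ℂ) (hgm : Measurable g) (hg : Integrable g) :
    L2R3 →L[ℂ] L2R3 :=
  LinearMap.mkContinuous
    { toFun := fun f => (memLp_conv hgm hg (measurable_coeFn_L2R3 f) (Lp.memLp f)).toLp _
      map_add' := fun f₁ f₂ => by
        rw [← MemLp.toLp_add, MemLp.toLp_eq_toLp_iff]
        filter_upwards [ae_integrable_conv hgm hg (measurable_coeFn_L2R3 f₁) (Lp.memLp f₁),
          ae_integrable_conv hgm hg (measurable_coeFn_L2R3 f₂) (Lp.memLp f₂)] with x h1 h2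
        rw [Pi.add_apply, ← integral_add h1 h2]
        refine integral_congr_ae ?_
        filter_upwards [Lp.coeFn_add f₁ f₂] with y hy
        rw [hy, Pi.add_apply, mul_add]
      map_smul' := fun c f => by
        rw [RingHom.id_apply, ← MemLp.toLp_const_smul, MemLp.toLp_eq_toLp_iff]
        refine Filter.Eventually.of_forall fun x => ?_
        rw [Pi.smul_apply, ← integral_smul]
        refine integral_congr_ae ?_
        filter_upwards [Lp.coeFn_smul c f] with y hy
        rw [hy, Pi.smul_apply, mul_smul_comm] }
    (eLpNorm g 1).toReal fun f => by
      have h := eLpNorm_conv_le hgm (measurable_coeFn_L2R3 f)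
      rw [LinearMap.coe_mk, AddHom.coe_mk, Lp.norm_toLp, Lp.norm_def, ← ENNReal.toReal_mul]
      exact ENNReal.toReal_mono (ENNReal.mul_lt_top (memLp_one_iff_integrable.2 hg).2
        (Lp.memLp f).2).ne h

theorem convL2_coeFn (g : R3 → ℂ) (hgm : Measurable g) (hg : Integrable g) (f : L2R3) :
    convL2 g hgm hg f =ᵐ[volume] fun x => ∫ y, g (x - y) * f y :=
  MemLp.coeFn_toLp (memLp_conv hgm hg (measurable_coeFn_L2R3 f) (Lp.memLp f))

/-- Moving a convolution operator to the test function. -/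
theorem integral_mul_convL2 (g : R3 → ℂ) (hgm : Measurable g) (hg : Integrable g) (f : L2R3)
    (φ : 𝓢(R3, ℂ)) :
    ∫ x, φ x * convL2 g hgm hg f x = ∫ y, (∫ x, g (x - y) * φ x) * f y := by
  have hfm := measurable_coeFn_L2R3 f
  have hφm : Measurable φ := φ.continuous.measurable
  have hint : Integrable (fun p : R3 × R3 => φ p.1 * (g (p.1 - p.2) * f p.2)) := by
    refine (integrable_prod_iff (Measurable.aestronglyMeasurable (by fun_prop))).2 ⟨?_, ?_⟩
    · filter_upwards [ae_integrable_conv hgm hg hfm (Lp.memLp f)] with x hx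
      exact hx.const_mul _
    · simp only [norm_mul, integral_const_mul]
      exact (φ.memLp 2).norm.integrable_mul
        (memLp_conv hgm.norm hg.norm hfm.norm (Lp.memLp f).norm)
  calc ∫ x, φ x * convL2 g hgm hg f x = ∫ x, ∫ y, φ x * (g (x - y) * f y) := by
        refine integral_congr_ae ?_
        filter_upwards [convL2_coeFn g hgm hg f] with x hx
        rw [hx, integral_const_mul]
    _ = ∫ y, ∫ x, φ x * (g (x - y) * f y) := integral_integral_swap hint
    _ = _ := by
        refine integral_congr_ae (Filter.Eventually.of_forall fun y => ?_)
        dsimp only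
        rw [← integral_mul_const]
        refine integral_congr_ae (Filter.Eventually.of_forall fun x => ?_)
        dsimp only
        ring

/-! ### The free resolvent -/

/-- The symbol `4π²|ξ|² - z` of `-Δ - z` for the Fourier transform with kernel `e^{-2πi⟨x,ξ⟩}`. -/
noncomputable def helmholtzSymbol (z : ℂ) (ξ : R3) : ℂ :=
  (((2 * Real.pi) ^ 2 * ‖ξ‖ ^ 2 : ℝ) : ℂ) - z

theorem hasTemperateGrowth_helmholtzSymbol (z : ℂ) : (helmholtzSymbol z).HasTemperateGrowth := by
  unfold helmholtzSymbol
  fun_prop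

theorem helmholtzSymbol_ne_zero {k : ℂ} (hk : 0 < k.im) (ξ : R3) :
    helmholtzSymbol (k ^ 2) ξ ≠ 0 := by
  have e : helmholtzSymbol (k ^ 2) ξ = -((k + (2 * Real.pi * ‖ξ‖ : ℝ)) *
      (k - (2 * Real.pi * ‖ξ‖ : ℝ))) := by
    rw [helmholtzSymbol]; push_cast; ring
  rw [e, neg_ne_zero]
  refine mul_ne_zero (fun h => ?_) (fun h => ?_) <;>
  · have := congrArg Complex.im h
    simp only [Complex.add_im, Complex.sub_im, Complex.ofReal_im, add_zero, sub_zero,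
      Complex.zero_im] at this
    exact hk.ne' this

open FourierTransform

/-- On Schwartz functions `-Δ - z` is multiplication by its symbol on the Fourier side. -/
theorem fourier_helmholtz (z : ℂ) (φ : 𝓢(R3, ℂ)) :
    𝓕 (-(Δ φ) - z • φ) = SchwartzMap.smulLeftCLM ℂ (helmholtzSymbol z) (𝓕 φ) := by
  have h1 : 𝓕 (SchwartzMap.fourierMultiplierCLM ℂ (fun ξ : R3 => ‖ξ‖ ^ 2) φ) =
      SchwartzMap.smulLeftCLM ℂ (fun ξ : R3 => ‖ξ‖ ^ 2) (𝓕 φ) := by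
    rw [SchwartzMap.fourierMultiplierCLM_apply, fourier_fourierInv_eq]
  have h2 : -(Δ φ) - z • φ = ((2 * Real.pi) ^ 2 : ℂ) •
      SchwartzMap.fourierMultiplierCLM ℂ (fun ξ : R3 => ‖ξ‖ ^ 2) φ + (-z) • φ := by
    rw [SchwartzMap.laplacian_eq_fourierMultiplierCLM]
    ext x
    simp
    rfl
  rw [h2, FourierTransform.fourier_add, FourierTransform.fourier_smul,
    FourierTransform.fourier_smul, h1]
  ext ξ
  simp only [add_apply, smul_apply]
  rw [SchwartzMap.smulLeftCLM_apply_apply (hasTemperateGrowth_helmholtzSymbol z),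
    SchwartzMap.smulLeftCLM_apply_apply (by fun_prop)]
  simp [helmholtzSymbol]
  ring

theorem integral_mul_fourierInv {g h : R3 → ℂ} (hg : Integrable g) (hh : Integrable h) :
    ∫ x, g x * 𝓕⁻ h x = ∫ ξ, 𝓕⁻ g ξ * h ξ := by
  have hflip : (-innerₗ R3).flip = -innerₗ R3 := by
    ext x y
    simp [real_inner_comm]
  have hc : Continuous fun p : R3 × R3 => (-innerₗ R3) p.1 p.2 := by
    simp only [LinearMap.neg_apply, innerₗ_apply_apply]
    fun_prop
  have := VectorFourier.integral_fourierIntegral_smul_eq_flip (μ := (volume : Measure R3))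
    (ν := volume) (L := -innerₗ R3) Real.continuous_fourierChar hc hg hh
  rw [hflip] at this
  exact this.symm

/-- The Yukawa kernel is a fundamental solution: `g(· - y)` is mapped by `-Δ - k²` to the Dirac
measure at `y`. -/
theorem integral_yukawa_mul_helmholtz {k : ℂ} (hk : 0 < k.im) (φ : 𝓢(R3, ℂ)) (y : R3) :
    ∫ x, yukawa k (x - y) * (-(Δ φ) - k ^ 2 • φ) x = φ y := by
  set ψ : 𝓢(R3, ℂ) := -(Δ φ) - k ^ 2 • φ with hψ
  have hFψ : ∀ ξ, 𝓕 ψ ξ = helmholtzSymbol (k ^ 2) ξ * 𝓕 φ ξ := fun ξ => by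
    rw [hψ, fourier_helmholtz,
      SchwartzMap.smulLeftCLM_apply_apply (hasTemperateGrowth_helmholtzSymbol _), smul_eq_mul]
  let h : R3 → ℂ := fun ξ => Complex.exp ((2 * Real.pi * inner ℝ ξ y : ℝ) * Complex.I) * 𝓕 ψ ξ
  have hh : Integrable h := by
    refine (𝓕 ψ).integrable.mono (Continuous.aestronglyMeasurable ?_) ?_
    · have := (𝓕 ψ).continuous
      fun_prop
    · refine Filter.Eventually.of_forall fun ξ => ?_
      simp only [h]
      rw [norm_mul, Complex.norm_exp_ofReal_mul_I, one_mul]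
  have hinv : ∀ (χ : 𝓢(R3, ℂ)) x, χ x =
      ∫ ξ, Complex.exp ((2 * Real.pi * inner ℝ ξ x : ℝ) * Complex.I) • 𝓕 χ ξ := fun χ x => by
    rw [← Real.fourierInv_eq', ← SchwartzMap.fourierInv_coe, fourierInv_fourier_eq]
  have hshift : ∀ x, ψ (x + y) = 𝓕⁻ h x := fun x => by
    rw [hinv, Real.fourierInv_eq']
    refine integral_congr_ae (Filter.Eventually.of_forall fun ξ => ?_)
    simp only [h, smul_eq_mul]
    rw [← mul_assoc, ← Complex.exp_add, inner_add_right]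
    push_cast
    ring_nf
  calc ∫ x, yukawa k (x - y) * ψ x = ∫ x, yukawa k x * ψ (x + y) := by
        rw [← integral_add_right_eq_self _ y]
        simp
    _ = ∫ ξ, 𝓕⁻ (yukawa k) ξ * h ξ := by
        simp_rw [hshift]
        exact integral_mul_fourierInv (integrable_yukawa hk) hh
    _ = φ y := by
        rw [hinv φ y]
        refine integral_congr_ae (Filter.Eventually.of_forall fun ξ => ?_)
        have hne := helmholtzSymbol_ne_zero hk ξ
        have hinv' : 𝓕⁻ (yukawa k) ξ = (helmholtzSymbol (k ^ 2) ξ)⁻¹ := fourierInv_yukawa hk ξ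
        simp only [h, hinv', hFψ, smul_eq_mul]
        field_simp

theorem helmholtz_toTemperedDistribution_apply (z : ℂ) (T : 𝓢'(R3, ℂ)) (φ : 𝓢(R3, ℂ)) :
    (-(Δ T) - z • T) φ = T (-(Δ φ) - z • φ) := by
  rw [map_sub, map_neg, map_smul, ← TemperedDistribution.laplacian_apply_apply]
  rfl

/-- `-Δ - k²` is injective on `L²(ℝ³)`: if `(-Δ - k²) u = 0` then the square-integrable function
`𝓕⁻ u` annihilates all products of the symbol with a test function, hence all test functions. -/
theorem eq_zero_of_helmholtz_eq_zero {k : ℂ} (hk : 0 < k.im) (u : L2R3)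
    (hu : -(Δ (Lp.toTemperedDistribution u)) - k ^ 2 • Lp.toTemperedDistribution u = 0) :
    u = 0 := by
  set v : L2R3 := 𝓕⁻ u with hv
  have hvu : Lp.toTemperedDistribution v = 𝓕⁻ (Lp.toTemperedDistribution u) :=
    (Lp.fourierInv_toTemperedDistribution_eq u).symm
  have hv0 : v = 0 := by
    rw [Lp.eq_zero_iff_ae_eq_zero]
    refine ae_eq_zero_of_integral_contDiff_smul_eq_zero
      ((Lp.memLp v).locallyIntegrable (by norm_num)) fun ψ hψ hψc => ?_
    have h1 : HasCompactSupport fun ξ => (helmholtzSymbol (k ^ 2) ξ)⁻¹ * (ψ ξ : ℂ) :=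
      (hψc.comp_left (g := Complex.ofReal) rfl).mul_left
    have h2 : ContDiff ℝ (⊤ : ℕ∞) fun ξ => (helmholtzSymbol (k ^ 2) ξ)⁻¹ * (ψ ξ : ℂ) :=
      ((hasTemperateGrowth_helmholtzSymbol (k ^ 2)).1.inv fun ξ =>
        helmholtzSymbol_ne_zero hk ξ).mul (Complex.ofRealCLM.contDiff.comp hψ)
    set χ : 𝓢(R3, ℂ) := h1.toSchwartzMap h2 with hχ
    have hχs : ∀ ξ, SchwartzMap.smulLeftCLM ℂ (helmholtzSymbol (k ^ 2)) χ ξ = ψ ξ := fun ξ => by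
      rw [SchwartzMap.smulLeftCLM_apply_apply (hasTemperateGrowth_helmholtzSymbol _)]
      exact mul_inv_cancel_left₀ (helmholtzSymbol_ne_zero hk ξ) _
    have key : Lp.toTemperedDistribution v
        (SchwartzMap.smulLeftCLM ℂ (helmholtzSymbol (k ^ 2)) χ) = 0 := by
      have e : SchwartzMap.smulLeftCLM ℂ (helmholtzSymbol (k ^ 2)) χ =
          𝓕 (-(Δ (𝓕⁻ χ)) - k ^ 2 • 𝓕⁻ χ) := by
        rw [fourier_helmholtz, fourier_fourierInv_eq]
      rw [hvu, TemperedDistribution.fourierInv_apply, e, fourierInv_fourier_eq,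
        ← helmholtz_toTemperedDistribution_apply, hu]
      rfl
    rw [Lp.toTemperedDistribution_apply] at key
    rw [← key]
    refine integral_congr_ae (Filter.Eventually.of_forall fun ξ => ?_)
    simp only [hχs, smul_eq_mul, Complex.real_smul]
  have : u = 𝓕 v := by rw [hv, fourier_fourierInv_eq]
  rw [this, hv0, FourierTransform.fourier_zero]

/-- Convolution with the Yukawa kernel is the free resolvent at `k²`. -/
theorem isFreeResolvent_convL2_yukawa {k : ℂ} (hk : 0 < k.im) :
    IsFreeResolvent (k ^ 2) (convL2 (yukawa k) (measurable_yukawa k) (integrable_yukawa hk)) := by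
  set R := convL2 (yukawa k) (measurable_yukawa k) (integrable_yukawa hk)
  have hR : ∀ f : L2R3, -(Δ (Lp.toTemperedDistribution (R f))) -
      k ^ 2 • Lp.toTemperedDistribution (R f) = Lp.toTemperedDistribution f := fun f => by
    ext φ
    rw [helmholtz_toTemperedDistribution_apply, Lp.toTemperedDistribution_apply,
      Lp.toTemperedDistribution_apply]
    simp only [smul_eq_mul]
    rw [integral_mul_convL2]
    simp only [integral_yukawa_mul_helmholtz hk]
  intro f u
  refine ⟨fun h => h ▸ hR f, fun h => ?_⟩
  rw [← sub_eq_zero]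
  refine eq_zero_of_helmholtz_eq_zero hk _ ?_
  have hT : Lp.toTemperedDistribution (R f - u) =
      Lp.toTemperedDistribution (R f) - Lp.toTemperedDistribution u :=
    map_sub (Lp.toTemperedDistributionCLM ℂ (volume : Measure R3) 2) _ _
  ext φ
  have h1 := congrArg (fun T : 𝓢'(R3, ℂ) => T φ) (hR f)
  have h2 := congrArg (fun T : 𝓢'(R3, ℂ) => T φ) h
  simp only [helmholtz_toTemperedDistribution_apply] at h1 h2 ⊢
  rw [hT]
  exact sub_eq_zero.2 (h1.trans h2.symm)

/-! ### The kernel of the sandwiched resolvent -/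

/-- The integrand of the kernel is `g(x - z) V(z) g(z - y)`, where `g` is the Yukawa kernel. -/
theorem kernelIntegrand_eq (V : R3 → ℂ) (k : ℂ) (x y z : R3) :
    1 / (16 * (Real.pi : ℂ) ^ 2) * kernelIntegrand V k x y z =
      yukawa k (x - z) * (V z * yukawa k (z - y)) := by
  simp only [kernelIntegrand, yukawa]
  ring

/-- The sandwiched resolvent is an iterated convolution. Its order of integration may be changed
for almost every `x`, since `|g| * (|g| * |f|)` is square-integrable and hence finite almost
everywhere. -/
theorem isIntegralKernel_greenKernel (V : R3 →ᵇ ℂ) {k : ℂ} (hk : 0 < k.im) :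
    IsIntegralKernel (convL2 (yukawa k) (measurable_yukawa k) (integrable_yukawa hk) ∘L
      mulPotential V ∘L convL2 (yukawa k) (measurable_yukawa k) (integrable_yukawa hk))
      (greenKernel V k) := by
  intro f
  set R := convL2 (yukawa k) (measurable_yukawa k) (integrable_yukawa hk)
  have hgm := measurable_yukawa k
  have hg := integrable_yukawa hk
  have hfm := measurable_coeFn_L2R3 f
  have hVm : Measurable V := V.continuous.measurable
  have hRf : R f =ᵐ[volume] fun z => ∫ y, yukawa k (z - y) * f y := convL2_coeFn _ hgm hg f
  have hRVRf : R (mulPotential V (R f)) =ᵐ[volume]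
      fun x => ∫ z, yukawa k (x - z) * mulPotential V (R f) z :=
    convL2_coeFn _ hgm hg _
  have hHm := measurable_conv hgm.norm hfm.norm
  have hH := memLp_conv hgm.norm hg.norm hfm.norm (Lp.memLp f).norm
  filter_upwards [hRVRf, ae_integrable_conv hgm.norm hg.norm hHm hH] with x hx hxint
  have hprod : Integrable (fun p : R3 × R3 =>
      yukawa k (x - p.1) * (V p.1 * yukawa k (p.1 - p.2)) * f p.2) := by
    refine (integrable_prod_iff (Measurable.aestronglyMeasurable (by fun_prop))).2 ⟨?_, ?_⟩
    · filter_upwards [ae_integrable_conv hgm hg hfm (Lp.memLp f)] with z hz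
      refine (hz.const_mul (yukawa k (x - z) * V z)).congr ?_
      exact Filter.Eventually.of_forall fun y => by ring
    · refine (hxint.const_mul ‖V‖).mono ?_ ?_
      · refine Measurable.aestronglyMeasurable (StronglyMeasurable.measurable ?_)
        refine StronglyMeasurable.integral_prod_right' (f := fun p : R3 × R3 =>
          ‖yukawa k (x - p.1) * (V p.1 * yukawa k (p.1 - p.2)) * f p.2‖) ?_
        exact Measurable.stronglyMeasurable (by fun_prop)
      · refine Filter.Eventually.of_forall fun z => ?_
        have e : ∫ y, ‖yukawa k (x - z) * (V z * yukawa k (z - y)) * f y‖ =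
            ‖V z‖ * (‖yukawa k (x - z)‖ * ∫ y, ‖yukawa k (z - y)‖ * ‖f y‖) := by
          rw [← mul_assoc, ← integral_const_mul]
          refine integral_congr_ae (Filter.Eventually.of_forall fun y => ?_)
          simp only [norm_mul]
          ring
        rw [e, norm_mul, norm_norm, norm_mul ‖V‖, norm_norm]
        exact mul_le_mul_of_nonneg_right (V.norm_coe_le_norm z) (norm_nonneg _)
  have hkernel : ∀ y, greenKernel V k x y * f y =
      ∫ z, yukawa k (x - z) * (V z * yukawa k (z - y)) * f y := fun y => by
    rw [greenKernel, ← integral_const_mul, ← integral_mul_const]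
    simp only [kernelIntegrand_eq]
  refine ⟨?_, ?_⟩
  · simp only [hkernel]
    exact hprod.integral_prod_right
  · simp only [hkernel]
    rw [ContinuousLinearMap.comp_apply, ContinuousLinearMap.comp_apply, hx,
      ← integral_integral_swap hprod]
    refine integral_congr_ae ?_
    filter_upwards [mulPotential_coeFn V (R f), hRf] with z h1 h2
    rw [h1, h2, ← mul_assoc, ← integral_const_mul]
    refine integral_congr_ae (Filter.Eventually.of_forall fun y => ?_)
    dsimp only
    ring

/-! ### The pointwise bound on the kernel -/

theorem norm_fderiv_apply_le_norm_grad (V : R3 → ℂ) (z w : R3) :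
    ‖fderiv ℝ V z w‖ ≤ ‖grad V z‖ * ‖w‖ := by
  have hw : w = ∑ j, w j • EuclideanSpace.single j (1 : ℝ) := by
    have := (EuclideanSpace.basisFun (Fin 3) ℝ).sum_repr w
    simpa using this.symm
  have hg : ∀ j, fderiv ℝ V z (EuclideanSpace.single j 1) = grad V z j := fun j => rfl
  rw [EuclideanSpace.norm_eq, EuclideanSpace.norm_eq]
  calc ‖fderiv ℝ V z w‖ = ‖∑ j, w j • grad V z j‖ := by
        conv_lhs => rw [hw]
        simp only [map_sum, map_smul, hg]
    _ ≤ ∑ j, ‖grad V z j‖ * ‖w j‖ := by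
        refine (norm_sum_le _ _).trans (Finset.sum_le_sum fun j _ => ?_)
        rw [norm_smul, mul_comm]
    _ ≤ _ := Real.sum_mul_le_sqrt_mul_sqrt _ _ _

theorem hasDerivAt_spheroidal (b : OrthonormalBasis (Fin 3) ℝ R3) (c φ τ r : ℝ)
    (hr : 0 < r ^ 2 - c ^ 2) :
    HasDerivAt (fun r => spheroidal b c (φ, r, τ))
      (ofCoords b (τ, r / √(r ^ 2 - c ^ 2) * √(1 - τ ^ 2) * Real.cos φ,
        r / √(r ^ 2 - c ^ 2) * √(1 - τ ^ 2) * Real.sin φ)) r := by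
  have h := hasDerivAt_sqrt_sq_sub c r hr
  have h0 := ((hasDerivAt_id r).mul_const τ).smul_const (b 0)
  rw [one_mul] at h0
  unfold spheroidal ofCoords
  exact (h0.fun_add
    (((h.mul_const (√(1 - τ ^ 2))).mul_const (Real.cos φ)).smul_const (b 1))).fun_add
    (((h.mul_const (√(1 - τ ^ 2))).mul_const (Real.sin φ)).smul_const (b 2))

/-- Along a curve `r ↦ spheroidal b c (φ, r, τ)` the speed is `√(r² - c²τ²) / √(r² - c²)`. -/
theorem norm_deriv_spheroidal_le (b : OrthonormalBasis (Fin 3) ℝ R3) (c φ τ r : ℝ) (hr : 0 ≤ r)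
    (hrc : 0 < r ^ 2 - c ^ 2) (hτ : 0 ≤ 1 - τ ^ 2) :
    ‖ofCoords b (τ, r / √(r ^ 2 - c ^ 2) * √(1 - τ ^ 2) * Real.cos φ,
        r / √(r ^ 2 - c ^ 2) * √(1 - τ ^ 2) * Real.sin φ)‖ ≤ r / √(r ^ 2 - c ^ 2) := by
  rw [← sq_le_sq₀ (norm_nonneg _) (by positivity), norm_ofCoords_sq]
  have e : τ ^ 2 + (r / √(r ^ 2 - c ^ 2) * √(1 - τ ^ 2) * Real.cos φ) ^ 2 +
      (r / √(r ^ 2 - c ^ 2) * √(1 - τ ^ 2) * Real.sin φ) ^ 2 =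
      τ ^ 2 + (r / √(r ^ 2 - c ^ 2)) ^ 2 * √(1 - τ ^ 2) ^ 2 := by
    linear_combination (r / √(r ^ 2 - c ^ 2)) ^ 2 * √(1 - τ ^ 2) ^ 2 * Real.sin_sq_add_cos_sq φ
  rw [e, Real.sq_sqrt hτ]
  have h1 : 1 ≤ (r / √(r ^ 2 - c ^ 2)) ^ 2 := by
    rw [div_pow, Real.sq_sqrt hrc.le, one_le_div hrc]
    nlinarith [sq_nonneg c]
  nlinarith [sq_nonneg τ]

/-- One-dimensional integration by parts against the oscillating factor `e^{2ikr}`. -/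
theorem enorm_integral_exp_mul_le {k : ℂ} (hk : 0 < k.im) {c : ℝ} (hc : 0 ≤ c) {u : ℝ → ℂ}
    (huc : Continuous u) (hud : ∀ r, c < r → DifferentiableAt ℝ u r) {C : ℝ}
    (hC : ∀ r, ‖u r‖ ≤ C) :
    ‖∫ r in Ioi c, Complex.exp (Complex.I * (2 * k) * r) * u r‖ₑ ≤
      ENNReal.ofReal (1 / (2 * ‖k‖)) * (ENNReal.ofReal C + ∫⁻ r in Ioi c, ‖deriv u r‖ₑ) := by
  have hk0 : k ≠ 0 := by rintro rfl; simp at hk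
  by_cases htop : ∫⁻ r in Ioi c, ‖deriv u r‖ₑ = ∞
  · rw [htop, add_top, ENNReal.mul_top]
    · exact le_top
    · have : 0 < ‖k‖ := norm_pos_iff.2 hk0
      simp [hk0]
  set w : ℂ := Complex.I * (2 * k) with hw
  have hwre : w.re < 0 := by simp [hw]; linarith
  have hw0 : w ≠ 0 := by rintro h; simp [h] at hwre
  have hexp : ∀ r : ℝ, 0 ≤ r → ‖Complex.exp (w * r)‖ ≤ 1 := fun r hr => by
    rw [Complex.norm_exp, Complex.re_mul_ofReal]
    exact Real.exp_le_one_iff.2 (mul_nonpos_of_nonpos_of_nonneg hwre.le hr)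
  have hdu : IntegrableOn (deriv u) (Ioi c) :=
    ⟨(measurable_deriv u).aestronglyMeasurable, lt_top_iff_ne_top.2 htop⟩
  have hi1 : IntegrableOn (fun r : ℝ => Complex.exp (w * r) * u r) (Ioi c) :=
    (integrableOn_exp_mul_complex_Ioi hwre c).mul_bdd (c := C) huc.aestronglyMeasurable
      (Filter.Eventually.of_forall hC)
  have hi2 : IntegrableOn (fun r : ℝ => Complex.exp (w * r) * deriv u r) (Ioi c) := by
    refine hdu.bdd_mul (c := 1) (Continuous.aestronglyMeasurable (by fun_prop)) ?_
    filter_upwards [ae_restrict_mem measurableSet_Ioi] with r hr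
    exact hexp r (hc.trans (le_of_lt hr))
  have hd : ∀ r ∈ Ioi c, HasDerivAt (fun r : ℝ => w⁻¹ * (Complex.exp (w * r) * u r))
      (Complex.exp (w * r) * u r + w⁻¹ * (Complex.exp (w * r) * deriv u r)) r := by
    intro r hr
    have h0 : HasDerivAt (fun r : ℝ => (r : ℂ)) 1 r := Complex.ofRealCLM.hasDerivAt
    have h1 : HasDerivAt (fun r : ℝ => Complex.exp (w * r)) (Complex.exp (w * r) * (w * 1)) r :=
      (h0.const_mul w).cexp
    refine ((h1.mul (hud r hr).hasDerivAt).const_mul w⁻¹).congr_deriv ?_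
    field_simp
  have hlim : Filter.Tendsto (fun r : ℝ => w⁻¹ * (Complex.exp (w * r) * u r)) Filter.atTop
      (nhds 0) := by
    rw [← mul_zero w⁻¹]
    refine Filter.Tendsto.const_mul _ ?_
    exact (tendsto_exp_mul_atTop_zero hwre).zero_mul_isBoundedUnder_le
      (Filter.isBoundedUnder_of ⟨C, hC⟩)
  have hFTC := integral_Ioi_of_hasDerivAt_of_tendsto (f := fun r : ℝ =>
    w⁻¹ * (Complex.exp (w * r) * u r)) (Continuous.continuousWithinAt (by fun_prop)) hd
    (hi1.add (hi2.const_mul w⁻¹)) hlim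
  rw [integral_add hi1 (hi2.const_mul w⁻¹), integral_const_mul] at hFTC
  have e : ∫ r in Ioi c, Complex.exp (w * r) * u r = -w⁻¹ * (Complex.exp (w * c) * u c +
      ∫ r in Ioi c, Complex.exp (w * r) * deriv u r) := by
    linear_combination hFTC
  rw [e, enorm_mul]
  have hwn : ‖-w⁻¹‖ₑ = ENNReal.ofReal (1 / (2 * ‖k‖)) := by
    rw [← ofReal_norm, norm_neg, norm_inv, hw]
    simp
  rw [hwn]
  gcongr
  refine (enorm_add_le _ _).trans (add_le_add ?_ ?_)
  · rw [← ofReal_norm, norm_mul]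
    refine ENNReal.ofReal_le_ofReal ?_
    calc _ ≤ 1 * C := mul_le_mul (hexp c hc) (hC c) (norm_nonneg _) zero_le_one
      _ = C := one_mul C
  · refine (enorm_integral_le_lintegral_enorm _).trans
      (setLIntegral_mono' measurableSet_Ioi fun r hr => ?_)
    rw [enorm_mul]
    refine mul_le_of_le_one_left' ?_
    rw [← ofReal_norm]
    exact ENNReal.ofReal_le_one.2 (hexp r (hc.trans (le_of_lt hr)))

section Bound

variable (V : R3 →ᵇ ℂ) {k : ℂ} {x y m : R3} {c : ℝ} (b : OrthonormalBasis (Fin 3) ℝ R3)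

/-- The coordinates are centred at the midpoint `m` of the foci `x = m + c b₀`, `y = m - c b₀`. -/
theorem norm_sub_add_spheroidal (hx : x = m + c • b 0) (hc : 0 ≤ c) (p : ℝ × ℝ × ℝ)
    (h1 : c ≤ p.2.1) (h2 : |p.2.2| ≤ 1) :
    ‖m + spheroidal b c p - x‖ = p.2.1 - c * p.2.2 := by
  rw [hx, add_sub_add_left_eq_sub]
  exact norm_spheroidal_sub_smul b c c rfl p (by rwa [abs_of_nonneg hc]) h2

theorem norm_add_spheroidal_sub (hy : y = m - c • b 0) (hc : 0 ≤ c) (p : ℝ × ℝ × ℝ)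
    (h1 : c ≤ p.2.1) (h2 : |p.2.2| ≤ 1) :
    ‖m + spheroidal b c p - y‖ = p.2.1 + c * p.2.2 := by
  rw [hy, sub_eq_add_neg m, add_sub_add_left_eq_sub, ← neg_smul]
  simpa using norm_spheroidal_sub_smul b c (-c) (neg_sq c) p (by rwa [abs_of_nonneg hc]) h2

/-- The volume element of the spheroidal coordinates with foci `x`, `y` cancels the denominator of
the integrand. -/
theorem density_smul_kernelIntegrand (hx : x = m + c • b 0) (hy : y = m - c • b 0) (hc : 0 ≤ c)
    (p : ℝ × ℝ × ℝ) (h1 : c < p.2.1) (h2 : |p.2.2| ≤ 1) :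
    (p.2.1 ^ 2 - c ^ 2 * p.2.2 ^ 2) • kernelIntegrand V k x y (m + spheroidal b c p) =
      Complex.exp (Complex.I * (2 * k) * p.2.1) * V (m + spheroidal b c p) := by
  have hcτ : |c * p.2.2| < p.2.1 := by
    rw [abs_mul, abs_of_nonneg hc]
    exact (mul_le_of_le_one_right hc h2).trans_lt h1
  obtain ⟨h3, h4⟩ := abs_lt.1 hcτ
  have e1 : ((p.2.1 - c * p.2.2 : ℝ) : ℂ) ≠ 0 := by
    exact_mod_cast (by linarith : 0 < p.2.1 - c * p.2.2).ne'
  have e2 : ((p.2.1 + c * p.2.2 : ℝ) : ℂ) ≠ 0 := by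
    exact_mod_cast (by linarith : 0 < p.2.1 + c * p.2.2).ne'
  rw [kernelIntegrand, norm_sub_rev x, norm_sub_add_spheroidal b hx hc p h1.le h2,
    norm_add_spheroidal_sub b hy hc p h1.le h2, ← Complex.exp_add, Complex.real_smul,
    show p.2.1 ^ 2 - c ^ 2 * p.2.2 ^ 2 = (p.2.1 - c * p.2.2) * (p.2.1 + c * p.2.2) by ring,
    Complex.ofReal_mul, div_mul_eq_mul_div, mul_div_cancel₀ _ (mul_ne_zero e1 e2)]
  congr 2
  push_cast
  ring

theorem measurable_kernelIntegrand (k : ℂ) (x y : R3) : Measurable (kernelIntegrand V k x y) := by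
  have hV : Measurable V := V.continuous.measurable
  unfold kernelIntegrand
  fun_prop

theorem integrable_exp_mul_comp_spheroidal (hk : 0 < k.im) (m : R3) (c : ℝ) :
    Integrable (fun p => Complex.exp (Complex.I * (2 * k) * p.2.1) * V (m + spheroidal b c p))
      (spheroidalBase c) := by
  have hw : (Complex.I * (2 * k)).re < 0 := by simp; linarith
  have h := ((integrableOn_exp_mul_complex_Ioi hw c).comp_fst
    (volume.restrict (Ioo (-1 : ℝ) 1))).comp_snd (volume.restrict (Ioo (-Real.pi) Real.pi))
  have hS := continuous_spheroidal b c
  exact h.mul_bdd (c := ‖V‖) (Continuous.aestronglyMeasurable (by fun_prop))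
    (Filter.Eventually.of_forall fun p => V.norm_coe_le_norm _)

theorem integrable_kernelIntegrand (hk : 0 < k.im) (hx : x = m + c • b 0) (hy : y = m - c • b 0)
    (hc : 0 ≤ c) : Integrable (kernelIntegrand V k x y) := by
  have hm := measurable_kernelIntegrand V k x y
  have h : Integrable fun z => kernelIntegrand V k x y (m + z) := by
    rw [integrable_spheroidal_iff b c hc (Measurable.aestronglyMeasurable (by fun_prop))]
    refine (integrable_exp_mul_comp_spheroidal V b hk m c).congr ?_
    filter_upwards [ae_spheroidalBase c] with p ⟨h1, h2, h3⟩
    exact (density_smul_kernelIntegrand V b hx hy hc p h1 (abs_le.2 ⟨h2.le, h3.le⟩)).symm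
  simpa using h.comp_add_left (-m)

/-- In spheroidal coordinates with foci `x` and `y` the kernel becomes an integral of `V` against
the factor `e^{2ikr}` alone. -/
theorem integral_kernelIntegrand (hx : x = m + c • b 0) (hy : y = m - c • b 0) (hc : 0 ≤ c) :
    ∫ z, kernelIntegrand V k x y z = ∫ p, Complex.exp (Complex.I * (2 * k) * p.2.1) *
      V (m + spheroidal b c p) ∂spheroidalBase c := by
  have hm := measurable_kernelIntegrand V k x y
  rw [← integral_add_left_eq_self _ m, integral_spheroidal b c hc
    (Measurable.aestronglyMeasurable (by fun_prop))]
  refine integral_congr_ae ?_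
  filter_upwards [ae_spheroidalBase c] with p ⟨h1, h2, h3⟩
  exact density_smul_kernelIntegrand V b hx hy hc p h1 (abs_le.2 ⟨h2.le, h3.le⟩)

/-- Along a coordinate line of `r` the potential varies by no more than the gradient integral: the
line meets the ellipsoid `E(x, y, r)` at the parameter `r`, with speed at most `r / √(r² - c²)`.
-/
theorem lintegral_deriv_comp_spheroidal_le (hV : ContDiff ℝ 1 V) (hx : x = m + c • b 0)
    (hy : y = m - c • b 0) (hc : c = ‖x - y‖ / 2) (φ τ : ℝ) (hτ : |τ| ≤ 1) :
    ∫⁻ r in Ioi c, ‖deriv (fun r => V (m + spheroidal b c (φ, r, τ))) r‖ₑ ≤ gradIntegral V x y := by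
  have hc0 : 0 ≤ c := by rw [hc]; positivity
  rw [gradIntegral, ← hc]
  refine setLIntegral_mono' measurableSet_Ioi fun r (hr : c < r) => ?_
  have hrc : 0 < r ^ 2 - c ^ 2 := by nlinarith
  have hτ' : 0 ≤ 1 - τ ^ 2 := by nlinarith [sq_abs τ, abs_nonneg τ]
  have hd := ((hV.differentiable one_ne_zero) (m + spheroidal b c (φ, r, τ))).hasFDerivAt
    |>.comp_hasDerivAt r ((hasDerivAt_spheroidal b c φ τ r hrc).const_add m)
  have hE : m + spheroidal b c (φ, r, τ) ∈ ellipsoid x y r := by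
    rw [ellipsoid, mem_ofPred_eq, norm_sub_add_spheroidal b hx hc0 (φ, r, τ) hr.le hτ,
      norm_add_spheroidal_sub b hy hc0 (φ, r, τ) hr.le hτ]
    ring
  have hd' := hd.deriv
  rw [Function.comp_def] at hd'
  rw [hd']
  calc _ ≤ ENNReal.ofReal (‖grad V (m + spheroidal b c (φ, r, τ))‖ * (r / √(r ^ 2 - c ^ 2))) := by
        rw [← ofReal_norm]
        refine ENNReal.ofReal_le_ofReal ((norm_fderiv_apply_le_norm_grad _ _ _).trans ?_)
        exact mul_le_mul_of_nonneg_left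
          (norm_deriv_spheroidal_le b c φ τ r (hc0.trans hr.le) hrc hτ') (norm_nonneg _)
    _ = ‖grad V (m + spheroidal b c (φ, r, τ))‖ₑ * ENNReal.ofReal (r / √(r ^ 2 - c ^ 2)) := by
        rw [ENNReal.ofReal_mul (norm_nonneg _), ofReal_norm]
    _ ≤ _ := by
        gcongr
        exact le_iSup₂ (f := fun z (_ : z ∈ ellipsoid x y r) => ‖grad V z‖ₑ) _ hE

/-- The bound with the constant `1/π`, which the spheroidal coordinates give, in both terms. -/
theorem enorm_integral_kernelIntegrand_le (hV : ContDiff ℝ 1 V) (hk : 0 < k.im)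
    (hx : x = m + c • b 0) (hy : y = m - c • b 0) (hc : c = ‖x - y‖ / 2) :
    ‖∫ z, kernelIntegrand V k x y z‖ₑ ≤ ENNReal.ofReal (4 * Real.pi) *
      (ENNReal.ofReal (1 / (2 * ‖k‖)) * (ENNReal.ofReal ‖V‖ + gradIntegral V x y)) := by
  have hc0 : 0 ≤ c := by rw [hc]; positivity
  have hint := integrable_exp_mul_comp_spheroidal V b hk m c
  set B := ENNReal.ofReal (1 / (2 * ‖k‖)) * (ENNReal.ofReal ‖V‖ + gradIntegral V x y)
  have hS := continuous_spheroidal b c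
  have hr : ∀ φ, ∀ τ ∈ Ioo (-1 : ℝ) 1, ‖∫ r in Ioi c, Complex.exp (Complex.I * (2 * k) * r) *
      V (m + spheroidal b c (φ, r, τ))‖ₑ ≤ B := fun φ τ hτ => by
    have hτ' : |τ| ≤ 1 := abs_le.2 ⟨hτ.1.le, hτ.2.le⟩
    refine (enorm_integral_exp_mul_le hk hc0 (C := ‖V‖) (by fun_prop) (fun r hr => ?_)
      fun r => V.norm_coe_le_norm _).trans ?_
    · have hrc : 0 < r ^ 2 - c ^ 2 := by nlinarith
      exact ((hV.differentiable one_ne_zero) _).comp r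
        ((hasDerivAt_spheroidal b c φ τ r hrc).const_add m).differentiableAt
    · simp only [B]
      gcongr
      exact lintegral_deriv_comp_spheroidal_le V b hV hx hy hc φ τ hτ'
  rw [integral_kernelIntegrand V b hx hy hc0, integral_prod _ hint]
  calc _ ≤ ∫⁻ φ in Ioo (-Real.pi) Real.pi, 2 * B := by
        refine (enorm_integral_le_lintegral_enorm _).trans (lintegral_mono_ae ?_)
        filter_upwards [hint.prod_right_ae] with φ hφ
        rw [integral_prod_symm _ hφ]
        refine (enorm_integral_le_lintegral_enorm _).trans ?_
        refine (setLIntegral_mono' measurableSet_Ioo fun τ hτ => hr φ τ hτ).trans_eq ?_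
        rw [setLIntegral_const, Real.volume_Ioo, mul_comm]
        norm_num
    _ = _ := by
        rw [setLIntegral_const, Real.volume_Ioo, mul_comm, ← mul_assoc]
        congr 1
        rw [← ENNReal.ofReal_ofNat, ← ENNReal.ofReal_mul (by linarith [Real.pi_pos])]
        congr 1
        ring

end Bound

theorem mainTheorem5 (V : R3 →ᵇ ℂ) (hV : ContDiff ℝ 1 V) (k : ℂ) (hk : 0 < k.im) :
    (∃ R₀ : L2R3 →L[ℂ] L2R3, IsFreeResolvent (k ^ 2) R₀ ∧
      IsIntegralKernel (R₀ ∘L mulPotential V ∘L R₀) (greenKernel V k)) ∧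
    ∀ x y : R3, Integrable (kernelIntegrand V k x y) ∧
      ‖greenKernel V k x y‖ₑ ≤ ENNReal.ofReal (1 / (8 * ‖k‖)) *
        (ENNReal.ofReal (1 / Real.pi * ‖V‖) +
          ENNReal.ofReal (1 / √2) * gradIntegral V x y) := by
  refine ⟨⟨_, isFreeResolvent_convL2_yukawa hk, isIntegralKernel_greenKernel V hk⟩,
    fun x y => ?_⟩
  obtain ⟨b, hb⟩ := exists_orthonormalBasis_eq_norm_smul (x - y)
  have hc : (‖x - y‖ / 2) • b 0 = (1 / 2 : ℝ) • (x - y) := by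
    nth_rewrite 2 [hb]
    rw [smul_smul]
    congr 1
    ring
  have hx : x = (1 / 2 : ℝ) • (x + y) + (‖x - y‖ / 2) • b 0 := by rw [hc]; module
  have hy : y = (1 / 2 : ℝ) • (x + y) - (‖x - y‖ / 2) • b 0 := by rw [hc]; module
  refine ⟨integrable_kernelIntegrand V b hk hx hy (by positivity), ?_⟩
  have hpi := Real.pi_pos
  have hk0 : 0 < ‖k‖ := norm_pos_iff.2 (by rintro rfl; simp at hk)
  rw [greenKernel, enorm_mul]
  have e16 : ‖1 / (16 * (Real.pi : ℂ) ^ 2)‖ₑ = ENNReal.ofReal (1 / (16 * Real.pi ^ 2)) := by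
    rw [← ofReal_norm]
    simp [abs_of_pos hpi]
  rw [e16]
  calc _ ≤ ENNReal.ofReal (1 / (16 * Real.pi ^ 2)) * (ENNReal.ofReal (4 * Real.pi) *
        (ENNReal.ofReal (1 / (2 * ‖k‖)) * (ENNReal.ofReal ‖V‖ + gradIntegral V x y))) :=
        mul_le_mul_right (enorm_integral_kernelIntegrand_le V b hV hk hx hy rfl) _
    _ = ENNReal.ofReal (1 / (8 * ‖k‖)) * (ENNReal.ofReal (1 / Real.pi) *
          (ENNReal.ofReal ‖V‖ + gradIntegral V x y)) := by
        simp only [← mul_assoc]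
        rw [← ENNReal.ofReal_mul (by positivity), ← ENNReal.ofReal_mul (by positivity),
          ← ENNReal.ofReal_mul (by positivity)]
        congr 2
        field_simp
        norm_num
    _ ≤ _ := by
        rw [mul_add, ENNReal.ofReal_mul (by positivity) (p := 1 / Real.pi)]
        gcongr
        · exact (Real.sqrt_le_left (by norm_num)).2 (by norm_num) |>.trans
            (by linarith [Real.pi_gt_three] : (3 : ℝ) ≤ Real.pi)
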